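/- Let $M=\begin{pmatrix}a&b\\c&d\end{pmatrix}\in GL(2,\mathbb Z)$ be hyperbolic (no eigenvalue of modulus $1$) with positive trace $r=a+d>0$, let $T$ be the automorphism of $\mathbb T^2=\mathbb R^2/\mathbb Z^2$ given by $M$, and put $\sigma=\det M$, $D=r^2-4\sigma$, $\lambda=\frac{r+\sqrt D}{2}$ and $$f_T(x,y)=bx^2-(a-d)xy-cy^2 .$$ Let $\widetilde{\mathfrak X}$ be the additive semigroup of two-sided sequences $\varepsilon=(\varepsilon_n)_{n\in\mathbb Z}$ of nonnegative integers for which $\sum_{n\ge1}\varepsilon_n\lambda^{-n}$ and $\sum_{n\ge1}\varepsilon_{-n}\lambda^{-n}$ converge, with the topology of the distance $\sum_{n\in\mathbb Z}|\varepsilon_n-\varepsilon_n'|\lambda^{-|n|}$ (on sets of sequences with uniformly bounded terms this is the product topology), and let $(\tau\varepsilon)_n=\varepsilon_{n+1}$ be the shift. An *arithmetic coding* of $T$ is a pair $(\varphi,\mathfrak X)$ where - $\varphi:\widetilde{\mathfrak X}\to\mathbb T^2$ is a continuous semigroup homomorphism with $\varphi\tau=T\varphi$; - $\mathfrak X\subset\widetilde{\mathfrak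 X}$ is closed and shift-invariant ($\tau\mathfrak X=\mathfrak X$), and it is total: if $\varepsilon\in\mathfrak X$, $\varepsilon'\in\widetilde{\mathfrak X}$, and there is $N\in\mathbb Z$ such that for every $k\in\mathbb Z$ the sequence $(\varepsilon'_k,\varepsilon'_{k+1},\dots)$ is lexicographically less than $(\varepsilon_N,\varepsilon_{N+1},\dots)$, then $\varepsilon'\in\mathfrak X$; - $\varphi|_{\mathfrak X}$ is surjective, and it is one-to-one on the set of sequences in $\mathfrak X$ with finitely many nonzero terms. Then: 1. For every arithmetic coding $(\varphi,\mathfrak X)$ of $T$ there is $K\in\mathbb N$, depending on $\varphi$ only, such that Lebesgue almost every point of $\mathbb T^2$ has exactly $K$ preimages in $\mathfrak X$ under $\varphi$; $K$ is called the number of preimages of the coding. 2. Arithmetic codings of $T$ exist, and the minimal possible number $m(T)$ of preimages of an arithmetic coding of $T$ is $$m(T)=\min\{|f_T(u,v)|:(u,v)\in\mathbb Z^2\setminus\{(0,0)\}\}.$$ 3. The minimal arithmetic codings (those whose number of preimages is $m(T)$) are parametrized by the solutions $(u,v)\in\mathbb Z^2$ of $f_T(u,v)=\pm m(T)$. Precisely,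 for $(u,v)\in\mathbb Z^2$ put $$\begin{pmatrix}n\\k\end{pmatrix}=-\det M\cdot M\begin{pmatrix}-v\\u\end{pmatrix},\qquad \mathbf t_{u,v}=\left(\frac{-v+n\lambda}{\sqrt D},\ \frac{u+k\lambda}{\sqrt D}\right)\in\mathbb R^2 .$$ For every $(u,v)\in\mathbb Z^2$ the limit $$\varphi_{u,v}(\varepsilon)=\lim_{N\to\infty}\left(\Big(\sum_{n=-N}^{N}\varepsilon_n\lambda^{-n}\Big)\mathbf t_{u,v}\ \bmod\ \mathbb Z^2\right)$$ exists for all $\varepsilon\in\widetilde{\mathfrak X}$ and defines a semigroup homomorphism, and $(u,v)\mapsto\varphi_{u,v}$ is a bijection from the set of integer solutions of $f_T(u,v)=\pm m(T)$ onto the set of maps $\varphi$ of minimal arithmetic codings $(\varphi,\mathfrak X)$ of $T$. -/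

import Mathlib

open Topology

noncomputable section

namespace ArithCoding

/-- The discriminant `r ^ 2 - 4 σ` of the characteristic polynomial `x ^ 2 - r x + σ`. -/
def disc (M : Matrix (Fin 2) (Fin 2) ℤ) : ℤ := M.trace ^ 2 - 4 * M.det

/-- The eigenvalue `(r + √D) / 2` of `M`. -/
def eigen (M : Matrix (Fin 2) (Fin 2) ℤ) : ℝ := ((M.trace : ℝ) + √(disc M : ℝ)) / 2

/-- No eigenvalue of `M` lies on the unit circle. -/
def IsHyperbolic (M : Matrix (Fin 2) (Fin 2) ℤ) : Prop :=
  ∀ z ∈ spectrum ℂ (M.map (Int.cast : ℤ → ℂ)), ‖z‖ ≠ 1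

/-- The map of the torus `ℝ² / ℤ²` induced by the integral matrix `M`. -/
def toralMap (M : Matrix (Fin 2) (Fin 2) ℤ) (x : UnitAddTorus (Fin 2)) : UnitAddTorus (Fin 2) :=
  fun i => ∑ j, M i j • x j

/-- The quadratic form `b x ^ 2 - (a - d) x y - c y ^ 2` associated with the matrix
with rows `(a, b)` and `(c, d)`. -/
def assocForm (M : Matrix (Fin 2) (Fin 2) ℤ) (x y : ℤ) : ℤ :=
  M 0 1 * x ^ 2 - (M 0 0 - M 1 1) * (x * y) - M 1 0 * y ^ 2

/-- The additive semigroup of the two-sided sequences of nonnegative integers for which both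
series `∑_{n ≥ 1} ε_n λ ^ (-n)` and `∑_{n ≥ 1} ε_{-n} λ ^ (-n)` converge. -/
def PrimarySeq (lam : ℝ) : AddSubmonoid (ℤ → ℕ) where
  carrier := {e | Summable (fun n : ℕ => (e ((n : ℤ) + 1) : ℝ) / lam ^ (n + 1)) ∧
    Summable (fun n : ℕ => (e (-((n : ℤ) + 1)) : ℝ) / lam ^ (n + 1))}
  zero_mem' := by
    constructor <;> simp
  add_mem' := by
    rintro a b ⟨ha, ha'⟩ ⟨hb, hb'⟩
    constructor
    · refine (ha.add hb).congr fun n => ?_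
      simp [add_div]
    · refine (ha'.add hb').congr fun n => ?_
      simp only [Pi.add_apply, Nat.cast_add, add_div]

theorem summable_weighted {lam : ℝ} (e : PrimarySeq lam) :
    Summable (fun n : ℤ => (e.1 n : ℝ) / lam ^ n.natAbs) := by
  apply Summable.of_nat_of_neg_add_one
  · rw [← summable_nat_add_iff 1]
    refine e.2.1.congr fun n => ?_
    have : ((n + 1 : ℕ) : ℤ).natAbs = n + 1 := by omega
    rw [this]; push_cast; rfl
  · refine e.2.2.congr fun n => ?_
    have : (-((n : ℤ) + 1)).natAbs = n + 1 := by omega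
    rw [this]

/-- The sequence `n ↦ ε_n λ ^ (-|n|)` as an element of `ℓ¹(ℤ)`. -/
def weighted {lam : ℝ} (e : PrimarySeq lam) : lp (fun _ : ℤ => ℝ) 1 :=
  ⟨fun n => (e.1 n : ℝ) / lam ^ n.natAbs, by
    apply memℓp_gen
    refine (summable_weighted e).norm.congr fun n => ?_
    simp⟩

/-- The topology on `PrimarySeq lam` of the distance `∑_n |ε_n - ε'_n| λ ^ (-|n|)`. For `λ > 1` it
is the product (weak) topology on every set of sequences with uniformly bounded terms.
(For the product topology on all of `PrimarySeq lam`, every continuous shift-equivariant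
homomorphism to the torus would vanish.) -/
@[reducible]
def seqTopology (lam : ℝ) : TopologicalSpace (PrimarySeq lam) :=
  TopologicalSpace.induced weighted inferInstance

/-- The two-sided shift `(τ ε)_n = ε_{n + 1}`. -/
def shift {lam : ℝ} (e : PrimarySeq lam) : PrimarySeq lam :=
  ⟨fun n => e.1 (n + 1), by
    obtain ⟨h1, h2⟩ := e.2
    rcases eq_or_ne lam 0 with rfl | h0
    · constructor <;> simp
    constructor
    · refine (((summable_nat_add_iff 1).2 h1).mul_left lam).congr fun n => ?_
      push_cast
      rw [pow_succ lam (n + 1)]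
      field_simp
    · rw [← summable_nat_add_iff 1]
      refine (h2.mul_left lam⁻¹).congr fun n => ?_
      have : -(((n + 1 : ℕ) : ℤ) + 1) + 1 = -((n : ℤ) + 1) := by push_cast; ring
      beta_reduce
      rw [this, pow_succ lam (n + 1)]
      field_simp⟩

/-- A sequence is finite if it has only finitely many nonzero terms. -/
def IsFinite {lam : ℝ} (e : PrimarySeq lam) : Prop := (Function.support e.1).Finite

/-- The one-sided sequence `(ε_N, ε_{N+1}, …)`. -/
def tail {lam : ℝ} (e : PrimarySeq lam) (N : ℤ) : ℕ → ℕ := fun k => e.1 (N + k)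

/-- The strict lexicographic order on one-sided sequences. -/
def LexLess (x y : ℕ → ℕ) : Prop := ∃ n, (∀ k < n, x k = y k) ∧ x n < y n

/-- Together with a sequence `ε`, the set contains each sequence `ε'` all of whose tails are
lexicographically less than one and the same tail of `ε`. -/
def IsTotal {lam : ℝ} (X : Set (PrimarySeq lam)) : Prop :=
  ∀ e ∈ X, ∀ e' : PrimarySeq lam, (∃ N : ℤ, ∀ k : ℤ, LexLess (tail e' k) (tail e N)) → e' ∈ X

/-- The pair `(φ, X)` is an arithmetic coding of the toral automorphism with matrix `M`. -/
structure IsArithmeticCoding (M : Matrix (Fin 2) (Fin 2) ℤ)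
    (φ : PrimarySeq (eigen M) →+ UnitAddTorus (Fin 2)) (X : Set (PrimarySeq (eigen M))) :
    Prop where
  continuous : Continuous[seqTopology (eigen M), inferInstance] φ
  equivariant : ∀ e, φ (shift e) = toralMap M (φ e)
  closed : IsClosed[seqTopology (eigen M)] X
  shift_invariant : ∀ e, shift e ∈ X ↔ e ∈ X
  total : IsTotal X
  surjective : ∀ x, ∃ e ∈ X, φ e = x
  injective_finite : Set.InjOn φ {e | e ∈ X ∧ IsFinite e}

/-- Almost every point of the torus has exactly `K` preimages in `X` under `φ`. -/
def IsKToOne {lam : ℝ} (φ : PrimarySeq lam →+ UnitAddTorus (Fin 2)) (X : Set (PrimarySeq lam))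
    (K : ℕ) : Prop :=
  ∀ᵐ x : UnitAddTorus (Fin 2), {e | e ∈ X ∧ φ e = x}.encard = K

/-- The possible numbers of preimages of arithmetic codings. -/
def preimageNumbers (M : Matrix (Fin 2) (Fin 2) ℤ) : Set ℕ :=
  {K | ∃ φ X, IsArithmeticCoding M φ X ∧ IsKToOne φ X K}

/-- The minimal possible number `m(T)` of preimages of an arithmetic coding. -/
def minPreimages (M : Matrix (Fin 2) (Fin 2) ℤ) : ℕ := sInf (preimageNumbers M)

/-- An arithmetic coding with the minimal possible number of preimages. -/
def IsMinimalCoding (M : Matrix (Fin 2) (Fin 2) ℤ)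
    (φ : PrimarySeq (eigen M) →+ UnitAddTorus (Fin 2)) (X : Set (PrimarySeq (eigen M))) : Prop :=
  IsArithmeticCoding M φ X ∧ IsKToOne φ X (minPreimages M)

/-- The homoclinic point `((-v + n λ) / √D, (u + k λ) / √D)` with parameters `(u, v)`, in
coordinates of the plane, where `(n, k) = - det M • M (-v, u)`. -/
def homoclinicPoint (M : Matrix (Fin 2) (Fin 2) ℤ) (u v : ℤ) : Fin 2 → ℝ := fun i =>
  (((![-v, u] i : ℤ) : ℝ) + (((-M.det) • M.mulVec ![-v, u]) i : ℤ) * eigen M) / √(disc M : ℝ)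

/-- `φ ε = (∑_n ε_n λ ^ (-n)) t mod ℤ²` for all `ε`: the symmetric partial sums
`(∑_{|n| ≤ N} ε_n λ ^ (-n)) t`, reduced modulo `ℤ²`, converge to `φ ε` on the torus. -/
def IsGivenBySeries {lam : ℝ} (φ : PrimarySeq lam → UnitAddTorus (Fin 2)) (t : Fin 2 → ℝ) :
    Prop :=
  ∀ e : PrimarySeq lam, Filter.Tendsto
    (fun (N : ℕ) (i : Fin 2) =>
      (((∑ n ∈ Finset.Icc (-(N : ℤ)) N, (e.1 n : ℝ) * lam ^ (-n)) * t i : ℝ) : UnitAddCircle))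
    Filter.atTop (𝓝 (φ e))

end ArithCoding

end

/-!
The numbers are expanded in the base `λ`, the admissible sequences being those whose tails do not
exceed the quasi-greedy expansion of `1`. The natural extension of this numeration lives on an
L-shaped domain in the plane, which is a fundamental domain of `ℤ[λ]` embedded by the two
conjugations, so that almost every point of the plane modulo `ℤ[λ]` has exactly one admissible code.
The map `φ_{u,v}` carries `ℤ[λ]` onto a sublattice of index `|f_T(u, v)|` in `ℤ²`; almost every
point of the torus therefore has `|f_T(u, v)|` admissible codes.

Conversely, a continuous equivariant homomorphism is determined by the image of the sequence with
the single digit `1` at `0`. This point is homoclinic to `0`, and the homoclinic points are the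
`t_{u,v}` modulo `ℤ²`. The set of any coding consists of the admissible sequences, up to sequences
that code a null set. If it omitted an admissible sequence, then by closedness and totality the
tails of all its members would fall below the expansion of `1` within a bounded window, and such
sequences have a null set of values. A tail with infinitely many nonzero digits that exceeds the
expansion of `1` would bring into it two finite sequences with the same image.
-/

noncomputable section

namespace ArithCoding

/-- The conjugate `(r - √D) / 2` of the eigenvalue `(r + √D) / 2`. -/
def conjEigen (M : Matrix (Fin 2) (Fin 2) ℤ) : ℝ := M.trace - eigen M

/-- The standing assumptions on `M`: it is a hyperbolic element of `GL(2, ℤ)` of positive trace. -/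
structure IsHyperbolicUnit (M : Matrix (Fin 2) (Fin 2) ℤ) : Prop where
  isUnit_det : IsUnit M.det
  isHyperbolic : IsHyperbolic M
  trace_pos : 0 < M.trace

section Eigenvalues

variable {M : Matrix (Fin 2) (Fin 2) ℤ}

theorem sqrt_disc_eq (M : Matrix (Fin 2) (Fin 2) ℤ) :
    √(disc M : ℝ) = eigen M - conjEigen M := by
  simp only [conjEigen, eigen]; ring

theorem eigen_add_conjEigen (M : Matrix (Fin 2) (Fin 2) ℤ) :
    eigen M + conjEigen M = M.trace :=
  add_sub_cancel _ _

theorem IsHyperbolic.norm_ne_one_of_root (hM : IsHyperbolic M) {z : ℂ}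
    (hz : z ^ 2 - M.trace * z + M.det = 0) : ‖z‖ ≠ 1 := by
  refine hM z ?_
  have htrace : (M.map (Int.cast : ℤ → ℂ)).trace = M.trace := by simp [Matrix.trace_fin_two]
  have hdet : (M.map (Int.cast : ℤ → ℂ)).det = M.det := by simp [Matrix.det_fin_two]
  simp [Matrix.mem_spectrum_iff_isRoot_charpoly, Matrix.charpoly_fin_two, Polynomial.IsRoot,
    htrace, hdet, hz]

namespace IsHyperbolicUnit

theorem trace_ne_one (hM : IsHyperbolicUnit M) (hdet : M.det = 1) : M.trace ≠ 1 := by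
  intro htr
  have hsqrt : (√3 : ℝ) ^ 2 = 3 := Real.sq_sqrt (by norm_num)
  refine hM.isHyperbolic.norm_ne_one_of_root (z := ⟨1 / 2, √3 / 2⟩) ?_ ?_
  · rw [hdet, htr]
    apply Complex.ext <;>
      simp only [one_div, pow_two, Int.cast_one, one_mul, Complex.add_re, Complex.sub_re,
        Complex.mul_re, Complex.one_re, Complex.zero_re, Complex.add_im, Complex.sub_im,
        Complex.mul_im, Complex.one_im, Complex.zero_im]
    · nlinarith
    · ring
  · rw [← sq_eq_sq₀ (norm_nonneg _) zero_le_one, ← Complex.normSq_eq_norm_sq, Complex.normSq_mk]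
    nlinarith

theorem trace_ne_two (hM : IsHyperbolicUnit M) (hdet : M.det = 1) : M.trace ≠ 2 := fun htr =>
  hM.isHyperbolic.norm_ne_one_of_root (z := 1) (by rw [hdet, htr]; norm_num) norm_one

theorem three_le_trace (hM : IsHyperbolicUnit M) (hdet : M.det = 1) : 3 ≤ M.trace := by
  have := hM.trace_pos
  have := hM.trace_ne_one hdet
  have := hM.trace_ne_two hdet
  omega

theorem disc_pos (hM : IsHyperbolicUnit M) : 0 < disc M := by
  rcases Int.isUnit_iff.1 hM.isUnit_det with h | h
  · have := hM.three_le_trace h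
    rw [disc, h]; nlinarith
  · rw [disc, h]; nlinarith

theorem sqrt_disc_pos (hM : IsHyperbolicUnit M) : 0 < √(disc M : ℝ) :=
  Real.sqrt_pos.2 (by exact_mod_cast hM.disc_pos)

theorem eigen_mul_conjEigen (hM : IsHyperbolicUnit M) : eigen M * conjEigen M = M.det := by
  have hsqrt : √(disc M : ℝ) ^ 2 = disc M := Real.sq_sqrt (by exact_mod_cast hM.disc_pos.le)
  calc eigen M * conjEigen M = ((M.trace : ℝ) ^ 2 - √(disc M : ℝ) ^ 2) / 4 := by
        simp only [conjEigen, eigen]; ring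
    _ = M.det := by rw [hsqrt, disc]; push_cast; ring

theorem one_lt_eigen (hM : IsHyperbolicUnit M) : 1 < eigen M := by
  have htr : (1 : ℝ) ≤ M.trace := by exact_mod_cast hM.trace_pos
  have hsqrt : (1 : ℝ) < √(disc M : ℝ) := by
    have h : 1 < disc M := by
      rcases Int.isUnit_iff.1 hM.isUnit_det with h | h
      · have := hM.three_le_trace h
        rw [disc, h]; nlinarith
      · have := hM.trace_pos
        rw [disc, h]; nlinarith
    rw [Real.lt_sqrt zero_le_one, one_pow]
    exact_mod_cast h
  rw [eigen]; linarith

theorem eigen_pos (hM : IsHyperbolicUnit M) : 0 < eigen M := zero_lt_one.trans hM.one_lt_eigen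

/-- If `r ^ 2 - 4 σ = s ^ 2`, then `(r - s) / 2` and `(r + s) / 2` are integers with product `σ`,
so both are units. -/
theorem not_isSquare_disc (hM : IsHyperbolicUnit M) : ¬ IsSquare (disc M) := by
  rintro ⟨s, hs⟩
  have hpos := hM.disc_pos
  have htr := hM.trace_pos
  rw [disc] at hs hpos
  obtain ⟨t, ht⟩ : (2 : ℤ) ∣ M.trace - s := by
    rw [← even_iff_two_dvd, Int.even_sub, ← Int.even_pow' (m := M.trace) two_ne_zero,
      ← Int.even_pow' (m := s) two_ne_zero, ← Int.even_sub]
    exact ⟨2 * M.det, by linarith⟩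
  have hmul : t * (M.trace - t) = M.det := by
    obtain rfl : s = M.trace - 2 * t := by linarith
    linarith
  have hunit := hM.isUnit_det
  rw [← hmul] at hunit hpos
  obtain ⟨ht1, ht2⟩ := IsUnit.mul_iff.1 hunit
  rcases Int.isUnit_iff.1 ht1 with rfl | rfl <;> rcases Int.isUnit_iff.1 ht2 with h | h
  · rw [show M.trace = 2 by linarith] at hpos
    norm_num at hpos
  all_goals linarith

theorem irrational_eigen (hM : IsHyperbolicUnit M) : Irrational (eigen M) :=
  ((irrational_sqrt_intCast_iff.2 ⟨hM.not_isSquare_disc, hM.disc_pos.le⟩).intCast_add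
    M.trace).div_natCast two_ne_zero

theorem irrational_conjEigen (hM : IsHyperbolicUnit M) : Irrational (conjEigen M) :=
  hM.irrational_eigen.intCast_sub _

theorem det_mul_det (hM : IsHyperbolicUnit M) : M.det * M.det = 1 :=
  Int.isUnit_mul_self hM.isUnit_det

theorem abs_conjEigen (hM : IsHyperbolicUnit M) : |conjEigen M| = (eigen M)⁻¹ := by
  refine eq_inv_of_mul_eq_one_right ?_
  calc eigen M * |conjEigen M| = |eigen M * conjEigen M| := by
        rw [abs_mul, abs_of_pos hM.eigen_pos]
    _ = 1 := by
        rw [hM.eigen_mul_conjEigen, ← Int.cast_abs, Int.isUnit_iff_abs_eq.1 hM.isUnit_det,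
          Int.cast_one]

end IsHyperbolicUnit

end Eigenvalues

theorem eq_zero_of_intCast_add_mul_eq_zero {x : ℝ} (hx : Irrational x) {p q : ℤ}
    (h : (p : ℝ) + q * x = 0) : p = 0 ∧ q = 0 := by
  have hq : q = 0 := by
    by_contra hq
    exact ((hx.intCast_mul hq).intCast_add p).ne_zero h
  subst hq
  simpa using h

/-- The sum `∑_n ε_n w_n` of a sequence against real weights. -/
def weightedSum (w : ℤ → ℝ) (e : ℤ → ℕ) : ℝ := ∑' n, (e n : ℝ) * w n

/-- Weights bounded by `λ ^ (-|n|)`, so that summation against them is defined and continuous on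
`PrimarySeq lam`. -/
def IsDominated (lam : ℝ) (w : ℤ → ℝ) : Prop := ∀ n, |w n| ≤ (lam ^ n.natAbs)⁻¹

/-- The weights `λ ^ (-n)` on the positions `n ≥ 1`. -/
def futureWeight (lam : ℝ) (n : ℤ) : ℝ := if 0 < n then lam ^ (-n) else 0

/-- The weights `μ ^ (-n)` on the positions `n ≤ 0`. -/
def pastWeight (mu : ℝ) (n : ℤ) : ℝ := if n ≤ 0 then mu ^ (-n) else 0

/-- The value `∑_{n ≥ 1} ε_n λ ^ (-n)` of the future of a sequence. -/
def future (lam : ℝ) : (ℤ → ℕ) → ℝ := weightedSum (futureWeight lam)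

/-- The value `∑_{n ≤ 0} ε_n μ ^ (-n)` of the past of a sequence. -/
def past (mu : ℝ) : (ℤ → ℕ) → ℝ := weightedSum (pastWeight mu)

section Sequences

variable {lam : ℝ}

/-- A bounded sequence as an element of `PrimarySeq lam`. -/
def ofBounded (hlam : 1 < lam) (e : ℤ → ℕ) (B : ℕ) (h : ∀ n, e n ≤ B) : PrimarySeq lam :=
  ⟨e, by
    have hsummable (f : ℕ → ℕ) (hf : ∀ n, f n ≤ B) :
        Summable fun n => (f n : ℝ) / lam ^ (n + 1) := by
      have hgeom : Summable fun n : ℕ => (B : ℝ) * lam⁻¹ ^ (n + 1) :=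
        ((summable_nat_add_iff 1).2 (summable_geometric_of_lt_one (by positivity)
          (inv_lt_one_of_one_lt₀ hlam))).mul_left _
      refine hgeom.of_nonneg_of_le (fun n => by positivity) fun n => ?_
      rw [inv_pow, ← div_eq_mul_inv]
      gcongr
      exact hf n
    exact ⟨hsummable (fun n => e (n + 1)) fun n => h _,
      hsummable (fun n => e (-(n + 1))) fun n => h _⟩⟩

/-- A sequence with finitely many nonzero terms as an element of `PrimarySeq lam`. -/
def ofFinite (lam : ℝ) (e : ℤ → ℕ) (h : (Function.support e).Finite) : PrimarySeq lam :=
  ⟨e, by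
    have hsummable (f : ℕ → ℤ) (hf : Function.Injective f) :
        Summable fun n => (e (f n) : ℝ) / lam ^ (n + 1) := by
      refine summable_of_hasFiniteSupport ((h.preimage hf.injOn).subset fun n hn => ?_)
      contrapose! hn
      simp_all
    exact ⟨hsummable (fun n => n + 1) fun a b hab => by simpa using hab,
      hsummable (fun n => -(n + 1)) fun a b hab => by simpa using hab⟩⟩

/-- The sequence whose only nonzero term is a `1` in position `n`. -/
def single (lam : ℝ) (n : ℤ) : PrimarySeq lam :=
  ofFinite lam (Pi.single n 1) ((Set.finite_singleton n).subset Pi.support_single_subset)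

/-- The restriction of a sequence to a finite set of positions. -/
def restrict (e : PrimarySeq lam) (s : Finset ℤ) : PrimarySeq lam :=
  ofFinite lam (fun n => if n ∈ s then e.1 n else 0)
    (s.finite_toSet.subset fun n hn => by
      by_contra h
      simp_all)

theorem add_apply (e e' : PrimarySeq lam) (m : ℤ) : (e + e').1 m = e.1 m + e'.1 m := rfl

theorem nsmul_apply (k : ℕ) (e : PrimarySeq lam) (m : ℤ) : (k • e).1 m = k * e.1 m := by
  simp

theorem single_apply (n m : ℤ) : (single lam n).1 m = if m = n then 1 else 0 := by
  simp [single, ofFinite, Pi.single_apply]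

theorem restrict_apply (e : PrimarySeq lam) (s : Finset ℤ) (n : ℤ) :
    (restrict e s).1 n = if n ∈ s then e.1 n else 0 := rfl

theorem restrict_eq_sum (e : PrimarySeq lam) (s : Finset ℤ) :
    restrict e s = ∑ n ∈ s, e.1 n • single lam n := by
  apply Subtype.ext
  ext m
  simp [restrict_apply, single, ofFinite, Finset.sum_apply, Pi.single_apply]

theorem shift_apply (e : PrimarySeq lam) (n : ℤ) : (shift e).1 n = e.1 (n + 1) := rfl

theorem shift_iterate_apply (e : PrimarySeq lam) (k : ℕ) (n : ℤ) :
    (shift^[k] e).1 n = e.1 (n + k) := by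
  induction k generalizing e n with
  | zero => simp
  | succ k ih =>
    rw [Function.iterate_succ_apply, ih, shift_apply]
    push_cast
    ring_nf

theorem shift_single (n : ℤ) : shift (single lam n) = single lam (n - 1) := by
  ext m
  simp only [shift_apply, single_apply, eq_sub_iff_add_eq]

theorem isFinite_ofFinite {e : ℤ → ℕ} (h : (Function.support e).Finite) :
    IsFinite (ofFinite lam e h) := h

theorem isFinite_single (n : ℤ) : IsFinite (single lam n) := isFinite_ofFinite _

theorem isFinite_restrict (e : PrimarySeq lam) (s : Finset ℤ) : IsFinite (restrict e s) :=
  isFinite_ofFinite _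

theorem IsFinite.add {e e' : PrimarySeq lam} (h : IsFinite e) (h' : IsFinite e') :
    IsFinite (e + e') :=
  (h.union h').subset (Function.support_add _ _)

theorem IsFinite.nsmul {e : PrimarySeq lam} (h : IsFinite e) (n : ℕ) : IsFinite (n • e) :=
  h.subset fun k hk => by
    contrapose! hk
    simp_all

theorem isFinite_shift {e : PrimarySeq lam} : IsFinite (shift e) ↔ IsFinite e :=
  ⟨fun h => Set.finite_of_finite_preimage h fun n _ => (Equiv.addRight (1 : ℤ)).surjective n,
    fun h => h.preimage (add_left_injective (1 : ℤ)).injOn⟩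

theorem IsFinite.exists_bounds {e : PrimarySeq lam} (he : IsFinite e) :
    ∃ n : ℕ, ∀ m : ℤ, e.1 m ≠ 0 → -n < m ∧ m < n := by
  obtain ⟨a, ha⟩ := he.bddAbove
  obtain ⟨b, hb⟩ := he.bddBelow
  refine ⟨a.natAbs + b.natAbs + 1, fun m hm => ?_⟩
  have hma : m ≤ a := ha hm
  have hbm : b ≤ m := hb hm
  constructor <;> omega

end Sequences

section WeightedSums

variable {lam mu : ℝ} {w : ℤ → ℝ}

theorem weightedSum_nsmul (k : ℕ) (e : PrimarySeq lam) :
    weightedSum w (k • e).1 = k * weightedSum w e.1 := by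
  simp only [weightedSum, nsmul_apply, Nat.cast_mul, mul_assoc, tsum_mul_left]

theorem weightedSum_single (n : ℤ) : weightedSum w (single lam n).1 = w n := by
  rw [weightedSum, tsum_eq_single n fun m hm => by simp [single_apply, hm]]
  simp [single_apply]

theorem weightedSum_shift (e : PrimarySeq lam) :
    weightedSum w (shift e).1 = weightedSum (fun n => w (n - 1)) e.1 := by
  rw [weightedSum, weightedSum,
    ← (Equiv.addRight (1 : ℤ)).tsum_eq fun n => (e.1 n : ℝ) * w (n - 1)]
  simp [shift_apply]

theorem hasSum_norm_weighted_sub (e e' : PrimarySeq lam) :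
    HasSum (fun n : ℤ => |(e.1 n : ℝ) - e'.1 n| / |lam| ^ n.natAbs)
      ‖weighted e - weighted e'‖ := by
  have h := lp.hasSum_norm (p := 1) (by norm_num) (weighted e - weighted e')
  simp only [ENNReal.toReal_one, Real.rpow_one] at h
  convert h using 2 with n
  rw [lp.coeFn_sub, Pi.sub_apply, weighted, weighted, ← sub_div, norm_div, norm_pow,
    Real.norm_eq_abs, Real.norm_eq_abs]

theorem summable_const_div_pow_natAbs (hlam : 1 < lam) (c : ℕ) :
    Summable fun n : ℤ => (c : ℝ) / lam ^ n.natAbs :=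
  summable_weighted (ofBounded hlam (fun _ => c) c fun _ => le_rfl)

namespace IsDominated

theorem norm_mul_le (hw : IsDominated lam w) (k : ℕ) (n : ℤ) :
    ‖(k : ℝ) * w n‖ ≤ k / lam ^ n.natAbs := by
  rw [norm_mul, Real.norm_natCast, div_eq_mul_inv]
  exact mul_le_mul_of_nonneg_left (hw n) (Nat.cast_nonneg k)

theorem summable (hw : IsDominated lam w) (e : PrimarySeq lam) :
    Summable fun n => (e.1 n : ℝ) * w n :=
  (summable_weighted e).of_norm_bounded fun n => hw.norm_mul_le _ n

theorem weightedSum_add (hw : IsDominated lam w) (e e' : PrimarySeq lam) :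
    weightedSum w (e + e').1 = weightedSum w e.1 + weightedSum w e'.1 := by
  simp only [weightedSum, ← (hw.summable e).tsum_add (hw.summable e'), add_apply, Nat.cast_add,
    add_mul]

theorem weightedSum_mul_add_single (hw : IsDominated lam w) (a b : ℝ) (m : ℤ)
    (e : PrimarySeq lam) :
    weightedSum (fun n => a * w n + (Pi.single m b : ℤ → ℝ) n) e.1 =
      a * weightedSum w e.1 + e.1 m * b := by
  have hsingle : HasSum (fun n => (e.1 n : ℝ) * (Pi.single m b : ℤ → ℝ) n) (e.1 m * b) := by
    simpa using hasSum_single (f := fun n => (e.1 n : ℝ) * (Pi.single m b : ℤ → ℝ) n) m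
      fun n hn => by simp [hn]
  rw [weightedSum, weightedSum, ← tsum_mul_left, ← hsingle.tsum_eq,
    ← ((hw.summable e).mul_left a).tsum_add hsingle.summable]
  exact tsum_congr fun n => by ring

theorem abs_weightedSum_le (hlam : 1 < lam) (hw : IsDominated lam w) {c : ℕ} {e : ℤ → ℕ}
    (he : ∀ n, e n ≤ c) : |weightedSum w e| ≤ ∑' n : ℤ, (c : ℝ) / lam ^ n.natAbs :=
  tsum_of_norm_bounded (summable_const_div_pow_natAbs hlam c).hasSum fun n =>
    (hw.norm_mul_le _ n).trans (by gcongr; exact he n)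

theorem abs_weightedSum_sub_le (hw : IsDominated lam w) (e e' : PrimarySeq lam) :
    |weightedSum w e.1 - weightedSum w e'.1| ≤ ‖weighted e - weighted e'‖ := by
  rw [weightedSum, weightedSum, ← (hw.summable e).tsum_sub (hw.summable e'), ← Real.norm_eq_abs]
  refine tsum_of_norm_bounded (hasSum_norm_weighted_sub e e') fun n => ?_
  rw [← sub_mul, norm_mul, Real.norm_eq_abs, Real.norm_eq_abs, div_eq_mul_inv, ← abs_pow,
    ← abs_inv]
  exact mul_le_mul_of_nonneg_left ((hw n).trans (le_abs_self _)) (abs_nonneg _)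

end IsDominated

theorem tendsto_iff_weighted {α : Type*} {l : Filter α} {f : α → PrimarySeq lam}
    {e : PrimarySeq lam} :
    Filter.Tendsto f l (@nhds _ (seqTopology lam) e) ↔
      Filter.Tendsto (fun a => weighted (f a)) l (𝓝 (weighted e)) := by
  rw [@nhds_induced, Filter.tendsto_comap_iff]; rfl

theorem IsDominated.continuous (hw : IsDominated lam w) :
    Continuous[seqTopology lam, inferInstance] fun e : PrimarySeq lam => weightedSum w e.1 := by
  let _ := seqTopology lam
  refine continuous_iff_continuousAt.2 fun e => ?_
  rw [ContinuousAt, tendsto_iff_norm_sub_tendsto_zero]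
  exact squeeze_zero (fun _ => norm_nonneg _) (fun a => hw.abs_weightedSum_sub_le a e)
    (tendsto_iff_norm_sub_tendsto_zero.1 (tendsto_iff_weighted.1 Filter.tendsto_id))

theorem IsDominated.continuousOn (hlam : 1 < lam) (hw : IsDominated lam w) (c : ℕ) :
    ContinuousOn (weightedSum w) (Set.univ.pi fun _ => Set.Iic c) := by
  refine continuousOn_tsum (fun n => ?_) (summable_const_div_pow_natAbs hlam c) fun n e he => ?_
  · exact ((continuous_of_discreteTopology.comp (continuous_apply n)).mul
      continuous_const).continuousOn
  · exact (hw.norm_mul_le _ n).trans (by gcongr; exact he n trivial)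

theorem continuous_coord (hlam : 1 < lam) (n : ℤ) :
    Continuous[seqTopology lam, inferInstance] fun e : PrimarySeq lam => e.1 n := by
  let _ := seqTopology lam
  have hpos : 0 < lam ^ n.natAbs := by positivity
  have hw : IsDominated lam (Pi.single n (lam ^ n.natAbs)⁻¹) := by
    intro m
    rcases eq_or_ne m n with rfl | hm
    · rw [Pi.single_eq_same, abs_of_pos (by positivity)]
    · rw [Pi.single_eq_of_ne hm, abs_zero]; positivity
  rw [Nat.isClosedEmbedding_coe_real.continuous_iff]
  refine (hw.continuous.mul_const (lam ^ n.natAbs)).congr fun e => ?_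
  rw [weightedSum, tsum_eq_single n fun m hm => by simp [hm], Pi.single_eq_same, mul_assoc,
    inv_mul_cancel₀ hpos.ne', mul_one]
  rfl

theorem tendsto_restrict (e : PrimarySeq lam) :
    Filter.Tendsto (restrict e) Filter.atTop (@nhds _ (seqTopology lam) e) := by
  rw [tendsto_iff_weighted]
  refine Filter.Tendsto.congr (fun s => ?_)
    (lp.hasSum_single (p := 1) (by norm_num) (weighted e))
  ext m
  rw [lp.coeFn_sum, Finset.sum_apply]
  simp only [lp.single_apply, weighted, restrict_apply]
  split_ifs with h <;> simp [h, Pi.single_apply]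

theorem hasSum_of_continuous {A : Type*} [AddCommMonoid A] [TopologicalSpace A]
    {φ : PrimarySeq lam →+ A} (hφ : Continuous[seqTopology lam, inferInstance] φ)
    (e : PrimarySeq lam) : HasSum (fun n => e.1 n • φ (single lam n)) (φ e) := by
  have hlim : Filter.Tendsto φ (@nhds _ (seqTopology lam) e) (𝓝 (φ e)) :=
    @Continuous.tendsto _ _ (seqTopology lam) _ _ hφ e
  refine (hlim.comp (tendsto_restrict e)).congr fun s => ?_
  simp [restrict_eq_sum]

theorem isDominated_futureWeight (hlam : 0 < lam) : IsDominated lam (futureWeight lam) := by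
  intro n
  rw [futureWeight]
  split_ifs with h
  · lift n to ℕ using h.le
    rw [abs_of_pos (by positivity), zpow_neg, zpow_natCast, Int.natAbs_natCast]
  · rw [abs_zero]; positivity

theorem isDominated_pastWeight (hmu : |mu| = lam⁻¹) : IsDominated lam (pastWeight mu) := by
  intro n
  have hlam : 0 ≤ lam := inv_nonneg.1 (hmu ▸ abs_nonneg mu)
  rw [pastWeight]
  split_ifs with h
  · obtain ⟨m, rfl⟩ : ∃ m : ℕ, n = -m := ⟨n.natAbs, by omega⟩
    simp [hmu]
  · rw [abs_zero]; positivity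

theorem future_add (hlam : 1 < lam) (e e' : PrimarySeq lam) :
    future lam (e + e').1 = future lam e.1 + future lam e'.1 :=
  (isDominated_futureWeight (zero_lt_one.trans hlam)).weightedSum_add e e'

theorem past_add (hmu : |mu| = lam⁻¹) (e e' : PrimarySeq lam) :
    past mu (e + e').1 = past mu e.1 + past mu e'.1 :=
  (isDominated_pastWeight hmu).weightedSum_add e e'

theorem future_nonneg (hlam : 0 < lam) (e : ℤ → ℕ) : 0 ≤ future lam e := by
  refine tsum_nonneg fun n => ?_
  rw [futureWeight]
  split_ifs <;> positivity

theorem future_eq_zero {e : ℤ → ℕ} (h : ∀ n > 0, e n = 0) : future lam e = 0 := by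
  rw [future, weightedSum, ← tsum_zero (β := ℤ)]
  refine tsum_congr fun n => ?_
  rw [futureWeight]
  split_ifs with hn
  · simp [h n hn]
  · simp

theorem past_eq_zero {e : ℤ → ℕ} (h : ∀ n ≤ 0, e n = 0) : past mu e = 0 := by
  rw [past, weightedSum, ← tsum_zero (β := ℤ)]
  refine tsum_congr fun n => ?_
  rw [pastWeight]
  split_ifs with hn
  · simp [h n hn]
  · simp

theorem future_shift (hlam : 1 < lam) (e : PrimarySeq lam) :
    future lam (shift e).1 = lam * future lam e.1 - e.1 1 := by
  have hlam0 : lam ≠ 0 := by linarith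
  have hweight (n : ℤ) :
      futureWeight lam (n - 1) = lam * futureWeight lam n + (Pi.single 1 (-1) : ℤ → ℝ) n := by
    rw [futureWeight, futureWeight]
    rcases lt_trichotomy n 1 with h | rfl | h
    · rw [if_neg (by omega), if_neg (by omega), Pi.single_eq_of_ne h.ne]; simp
    · simp [hlam0]
    · rw [if_pos (by omega), if_pos (by omega), Pi.single_eq_of_ne h.ne', neg_sub, sub_eq_add_neg,
        zpow_add₀ hlam0, zpow_one, add_zero]
  rw [future, weightedSum_shift, funext hweight,
    (isDominated_futureWeight (by linarith)).weightedSum_mul_add_single, mul_neg_one,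
    ← sub_eq_add_neg]

theorem past_shift (hlam : 1 < lam) (hmu : |mu| = lam⁻¹) (e : PrimarySeq lam) :
    past mu (shift e).1 = mu * past mu e.1 + e.1 1 := by
  have hmu0 : mu ≠ 0 := abs_pos.1 (by rw [hmu]; positivity)
  have hweight (n : ℤ) :
      pastWeight mu (n - 1) = mu * pastWeight mu n + (Pi.single 1 1 : ℤ → ℝ) n := by
    rw [pastWeight, pastWeight]
    rcases lt_trichotomy n 1 with h | rfl | h
    · rw [if_pos (by omega), if_pos (by omega), Pi.single_eq_of_ne h.ne, neg_sub, sub_eq_add_neg,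
        zpow_add₀ hmu0, zpow_one, add_zero]
    · simp
    · rw [if_neg (by omega), if_neg (by omega), Pi.single_eq_of_ne h.ne']; simp
  rw [past, weightedSum_shift, funext hweight,
    (isDominated_pastWeight hmu).weightedSum_mul_add_single, mul_one]

theorem future_shift_iterate_succ (hlam : 1 < lam) (e : PrimarySeq lam) (k : ℕ) :
    future lam (shift^[k + 1] e).1 = lam * future lam (shift^[k] e).1 - e.1 (k + 1) := by
  rw [Function.iterate_succ_apply', future_shift hlam, shift_iterate_apply, add_comm 1]

end WeightedSums

theorem lexLess_iff_toLex_lt {x y : ℕ → ℕ} : LexLess x y ↔ toLex x < toLex y := Iff.rfl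

theorem LexLess.trans {x y z : ℕ → ℕ} (h : LexLess x y) (h' : LexLess y z) : LexLess x z :=
  lt_trans (lexLess_iff_toLex_lt.1 h) (lexLess_iff_toLex_lt.1 h')

theorem LexLess.trans_le {x y z : ℕ → ℕ} (h : LexLess x y) (h' : y ≤ z) : LexLess x z :=
  lt_of_lt_of_le (lexLess_iff_toLex_lt.1 h) (Pi.toLex_monotone h')

theorem lexLess_of_lt {x y : ℕ → ℕ} (h : x < y) : LexLess x y :=
  Pi.toLex_strictMono h

theorem lexLess_of_apply_zero_lt {x y : ℕ → ℕ} (h : x 0 < y 0) : LexLess x y :=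
  ⟨0, by simp, h⟩

/-- No tail of the sequence is lexicographically greater than `d`. -/
def IsAdmissible (d : ℕ → ℕ) (e : ℤ → ℕ) : Prop := ∀ N : ℤ, ¬ LexLess d fun k => e (N + k)

/-- The set of the admissible sequences. -/
def admissibleSet (lam : ℝ) (d : ℕ → ℕ) : Set (PrimarySeq lam) := {e | IsAdmissible d e.1}

namespace IsAdmissible

variable {lam : ℝ} {d : ℕ → ℕ}

theorem le {e : ℤ → ℕ} (h : IsAdmissible d e) (n : ℤ) : e n ≤ d 0 := by
  by_contra! hlt
  exact h n (lexLess_of_apply_zero_lt (by simpa using hlt))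

theorem mono {e f : ℤ → ℕ} (he : IsAdmissible d e) (h : ∀ n, f n ≤ e n) : IsAdmissible d f :=
  fun N hN => he N (hN.trans_le fun k => h (N + k))

theorem comp_add {e : ℤ → ℕ} (h : IsAdmissible d e) (m : ℤ) :
    IsAdmissible d fun n => e (n + m) := by
  intro N
  simpa only [add_right_comm] using h (N + m)

theorem exists_shift_eq (hlam : 1 < lam) {e : PrimarySeq lam} (h : IsAdmissible d e.1) :
    ∃ e' : PrimarySeq lam, IsAdmissible d e'.1 ∧ shift e' = e := by
  refine ⟨ofBounded hlam (fun n => e.1 (n - 1)) (d 0) fun n => h.le _, h.comp_add (-1), ?_⟩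
  apply Subtype.ext
  ext n
  simp [shift_apply, ofBounded]

end IsAdmissible

theorem isAdmissible_shift {lam : ℝ} {d : ℕ → ℕ} {e : PrimarySeq lam} :
    IsAdmissible d (shift e).1 ↔ IsAdmissible d e.1 :=
  ⟨fun h => by simpa [shift_apply] using h.comp_add (-1), fun h => h.comp_add 1⟩

theorem isAdmissible_shift_iterate {lam : ℝ} {d : ℕ → ℕ} {e : PrimarySeq lam} {k : ℕ} :
    IsAdmissible d (shift^[k] e).1 ↔ IsAdmissible d e.1 := by
  induction k with
  | zero => rfl
  | succ k ih => rw [Function.iterate_succ_apply', isAdmissible_shift, ih]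

theorem IsFinite.tail_ne {lam : ℝ} {e : PrimarySeq lam} (he : IsFinite e) {f : ℕ → ℕ}
    (hf : ∃ᶠ n in Filter.atTop, f n ≠ 0) (k : ℤ) : tail e k ≠ f := by
  rintro rfl
  obtain ⟨b, hb⟩ := he.bddAbove
  obtain ⟨n, hne, hn⟩ := (hf.and_eventually (Filter.eventually_gt_atTop (b - k).toNat)).exists
  have : k + n ≤ b := hb hne
  omega

theorem IsFinite.lexLess_of_tail_le {lam : ℝ} {e : PrimarySeq lam} (he : IsFinite e)
    {f : ℕ → ℕ} (hf : ∃ᶠ n in Filter.atTop, f n ≠ 0) {k : ℤ} (h : tail e k ≤ f) :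
    LexLess (tail e k) f :=
  lexLess_of_lt (h.lt_of_ne (he.tail_ne hf k))

theorem isClosed_setOf_isAdmissible {Z : Type*} [TopologicalSpace Z] {f : Z → ℤ → ℕ}
    (hf : ∀ n, Continuous fun z => f z n) (d : ℕ → ℕ) : IsClosed {z | IsAdmissible d (f z)} := by
  simp only [IsAdmissible, LexLess, Set.ofPred_forall]
  refine isClosed_iInter fun N => isOpen_compl_iff.1 ?_
  have hset : {z | ¬∃ i, (∀ k < i, d k = f z (N + k)) ∧ d i < f z (N + i)}ᶜ =
      ⋃ i : ℕ, (⋂ k ∈ Finset.range i, (fun z => f z (N + k)) ⁻¹' {d k}) ∩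
        (fun z => f z (N + i)) ⁻¹' Set.Ioi (d i) := by
    ext z
    simp [eq_comm]
  rw [hset]
  exact isOpen_iUnion fun i => (isOpen_biInter_finset fun k _ =>
    (isOpen_discrete _).preimage (hf _)).inter ((isOpen_discrete _).preimage (hf _))

/-- The interior of the L-shaped domain of the natural extension, in the coordinates given by the
value of the future and the value of the past. -/
def InDomain (lam : ℝ) (r c : ℕ) (x y : ℝ) : Prop :=
  (0 < x ∧ x < 1) ∧ ((r : ℝ) - 1 - c < y ∧ y < lam) ∧ y ≠ lam - 1 ∧ (lam - 1 < y → x < lam - c)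

/-- The closed L-shaped domain, without the condition `0 ≤ x`. -/
def InClosedDomain (lam : ℝ) (r c : ℕ) (x y : ℝ) : Prop :=
  x ≤ 1 ∧ ((r : ℝ) - 1 - c ≤ y ∧ y ≤ lam) ∧ (lam - 1 < y → x ≤ lam - c)

/-- Two finite sequences with the same future and past values, all of whose tails are
lexicographically less than `f`. A total set on which a coding is one-to-one on finite sequences
cannot contain a sequence with tail `f`. -/
def HasFiniteCollision (lam mu : ℝ) (f : ℕ → ℕ) : Prop :=
  ∃ g h : PrimarySeq lam, IsFinite g ∧ IsFinite h ∧ g ≠ h ∧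
    (∀ k, LexLess (tail g k) f) ∧ (∀ k, LexLess (tail h k) f) ∧
    future lam g.1 = future lam h.1 ∧ past mu g.1 = past mu h.1

/-- The expansions in base `λ` for a quadratic unit `λ > 1` with conjugate `μ` and trace `r`. Here
`d` is the quasi-greedy expansion of `1`, with the first digit `c`, and `D i` is the value of its
`i`-th tail. -/
structure Numeration (lam mu : ℝ) (r c : ℕ) (d : ℕ → ℕ) (D : ℕ → ℝ) : Prop where
  one_lt : 1 < lam
  add_eq : lam + mu = r
  norm_unit : ∃ s : ℤ, s * s = 1 ∧ lam * mu = s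
  abs_conj : |mu| = lam⁻¹
  digit_zero : d 0 = c
  value_zero : D 0 = 1
  value_succ : ∀ i, D (i + 1) = lam * D i - d i
  value_pos : ∀ i, 0 < D i
  value_le : ∀ i, D i ≤ 1
  digit_lt : (c : ℝ) < lam
  lt_digit : lam < c + 1
  conj_lt : mu < c
  region : ∀ e : PrimarySeq lam, IsAdmissible d e.1 →
    InClosedDomain lam r c (future lam e.1) (past mu e.1)
  step : ∀ x y : ℝ, ∀ k : ℤ, InDomain lam r c x y → (k : ℝ) < lam * x → lam * x < k + 1 →
    InDomain lam r c (lam * x - k) (mu * y + k)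
  collision : ∀ f : ℕ → ℕ, LexLess d f → (∃ᶠ n in Filter.atTop, f n ≠ 0) →
    ∃ m, HasFiniteCollision lam mu fun n => f (n + m)

theorem le_of_contraction {ι : Type*} {s : Set ι} {F b : ι → ℝ} {lam : ℝ} (hlam : 1 < lam)
    (hbdd : ∃ B, ∀ i ∈ s, F i ≤ b i + B)
    (hstep : ∀ c, 0 ≤ c → (∀ i ∈ s, F i ≤ b i + c) → ∀ i ∈ s, F i ≤ b i + c / lam) {i : ι}
    (hi : i ∈ s) : F i ≤ b i := by
  obtain ⟨B, hB⟩ := hbdd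
  have hiterate (n : ℕ) : ∀ i ∈ s, F i ≤ b i + |B| / lam ^ n := by
    induction n with
    | zero => exact fun i hi => (hB i hi).trans (by gcongr; simpa using le_abs_self B)
    | succ n ih => simpa only [div_div, ← pow_succ] using hstep _ (by positivity) ih
  have hlim : Filter.Tendsto (fun n : ℕ => b i + |B| / lam ^ n) Filter.atTop (𝓝 (b i + 0)) :=
    (tendsto_const_nhds.div_atTop (tendsto_pow_atTop_atTop_of_one_lt hlam)).const_add _
  rw [add_zero] at hlim
  exact ge_of_tendsto' hlim fun n => hiterate n i hi

/-! ### Units of norm `-1` -/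

section NormNegOne

/-- The quasi-greedy expansion `r, 0, r, 0, …` of `1` in the base `λ` with `λ ^ 2 = r λ + 1`. -/
def digitsNegOne (r : ℕ) (i : ℕ) : ℕ := if Even i then r else 0

variable {lam mu : ℝ} {r : ℕ}

theorem exists_of_lexLess_digitsNegOne {f : ℕ → ℕ} (h : LexLess (digitsNegOne r) f) :
    ∃ m, r < f m ∨ f m = r ∧ 0 < f (m + 1) := by
  obtain ⟨i, heq, hlt⟩ := h
  rcases i.even_or_odd with heven | ⟨j, rfl⟩
  · exact ⟨i, Or.inl (by simpa [digitsNegOne, heven] using hlt)⟩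
  · have hnot : ¬Even (2 * j + 1) := by simp
    exact ⟨2 * j, Or.inr ⟨by simpa [digitsNegOne] using (heq (2 * j) (by omega)).symm,
      by simpa [digitsNegOne, hnot] using hlt⟩⟩

theorem IsAdmissible.eq_zero_of_eq_digit {e : ℤ → ℕ} (h : IsAdmissible (digitsNegOne r) e)
    {n : ℤ} (hn : e n = r) : e (n + 1) = 0 := by
  by_contra hne
  refine h n ⟨1, fun k hk => ?_, ?_⟩
  · obtain rfl : k = 0 := by omega
    simp [digitsNegOne, hn]
  · simpa [digitsNegOne, Nat.pos_iff_ne_zero] using hne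

theorem eq_neg_inv_of_mul_eq_neg_one (hlam : 1 < lam) (hmul : lam * mu = -1) : mu = -lam⁻¹ := by
  field_simp
  linarith

theorem abs_eq_inv_of_mul_eq_neg_one (hlam : 1 < lam) (hmul : lam * mu = -1) :
    |mu| = lam⁻¹ := by
  rw [eq_neg_inv_of_mul_eq_neg_one hlam hmul, abs_neg, abs_of_pos (by positivity)]

theorem neg_one_le_past (hlam : 1 < lam) (hmul : lam * mu = -1) (hadd : lam + mu = r)
    {e : PrimarySeq lam} (he : e ∈ admissibleSet lam (digitsNegOne r)) : -1 ≤ past mu e.1 := by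
  have hmu := eq_neg_inv_of_mul_eq_neg_one hlam hmul
  have habs := abs_eq_inv_of_mul_eq_neg_one hlam hmul
  refine neg_le.1 (le_of_contraction (F := fun e : PrimarySeq lam => -past mu e.1)
    (b := fun _ => 1) hlam ?_ (fun c hc hbound e he => ?_) he)
  · exact ⟨_, fun e he => (neg_le_abs _).trans (((isDominated_pastWeight habs).abs_weightedSum_le
      hlam fun n => he.le n).trans (le_add_of_nonneg_left zero_le_one))⟩
  · obtain ⟨e₁, he₁, rfl⟩ := IsAdmissible.exists_shift_eq hlam he
    obtain ⟨e₂, he₂, rfl⟩ := he₁.exists_shift_eq hlam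
    have hdigit : ((shift e₂).1 0 : ℝ) ≤ r := by exact_mod_cast he₁.le 0
    have hdigit' : (0 : ℝ) ≤ (shift e₂).1 1 := by positivity
    have hlower : -past mu e₂.1 ≤ 1 + c := hbound e₂ he₂
    have hupper : past mu (shift e₂).1 ≤ lam + c / lam := by
      calc past mu (shift e₂).1 = lam⁻¹ * -past mu e₂.1 + (shift e₂).1 0 := by
            rw [past_shift hlam habs, hmu, shift_apply]; ring_nf
        _ ≤ lam⁻¹ * (1 + c) + r := by gcongr
        _ = lam + c / lam := by rw [← hadd, hmu]; ring
    calc -past mu (shift (shift e₂)).1 = lam⁻¹ * past mu (shift e₂).1 - (shift e₂).1 1 := by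
          rw [past_shift hlam habs, hmu]; ring
      _ ≤ lam⁻¹ * (lam + c / lam) - 0 := by gcongr
      _ = 1 + c / lam / lam := by field_simp; ring
      _ ≤ 1 + c / lam := by gcongr; exact div_le_self (by positivity) hlam.le

theorem past_le_add_inv (hlam : 1 < lam) (hmul : lam * mu = -1) (hadd : lam + mu = r)
    {e : PrimarySeq lam} (he : e ∈ admissibleSet lam (digitsNegOne r)) :
    past mu e.1 ≤ e.1 0 + lam⁻¹ := by
  obtain ⟨e', he', rfl⟩ := IsAdmissible.exists_shift_eq hlam he
  have hlower := neg_one_le_past hlam hmul hadd he'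
  calc past mu (shift e').1 = (shift e').1 0 + lam⁻¹ * -past mu e'.1 := by
        rw [past_shift hlam (abs_eq_inv_of_mul_eq_neg_one hlam hmul),
          eq_neg_inv_of_mul_eq_neg_one hlam hmul, shift_apply]
        ring_nf
    _ ≤ (shift e').1 0 + lam⁻¹ * 1 := by gcongr; linarith
    _ = (shift e').1 0 + lam⁻¹ := by rw [mul_one]

theorem future_le_ite_eq (hlam : 1 < lam) (hmul : lam * mu = -1) (hadd : lam + mu = r)
    {e : PrimarySeq lam} (he : e ∈ admissibleSet lam (digitsNegOne r)) :
    future lam e.1 ≤ if e.1 0 = r then lam⁻¹ else 1 := by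
  have hmu := eq_neg_inv_of_mul_eq_neg_one hlam hmul
  have hpos : 0 < lam⁻¹ := by positivity
  refine le_of_contraction (F := fun e : PrimarySeq lam => future lam e.1)
    (b := fun e => if e.1 0 = r then lam⁻¹ else 1) hlam ?_ (fun c _ hbound e he => ?_) he
  · refine ⟨_, fun e he => (le_abs_self _).trans (((isDominated_futureWeight
      (by positivity)).abs_weightedSum_le hlam fun n => he.le n).trans
      (le_add_of_nonneg_left ?_))⟩
    split_ifs <;> positivity
  · have hshift := hbound (shift e) (isAdmissible_shift.2 he)
    rw [future_shift hlam, shift_apply, zero_add, sub_le_iff_le_add] at hshift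
    refine le_of_mul_le_mul_left (hshift.trans ?_) (by positivity : 0 < lam)
    rw [mul_add, mul_div_cancel₀ c (by positivity)]
    by_cases hzero : e.1 0 = r
    · have hnext : e.1 1 = 0 := by simpa using he.eq_zero_of_eq_digit hzero
      rw [if_pos hzero, hnext, mul_inv_cancel₀ (by positivity), Nat.cast_zero]
      split_ifs <;> linarith [inv_lt_one_of_one_lt₀ hlam]
    · rw [if_neg hzero]
      have hdigit : e.1 1 ≤ r := he.le 1
      split_ifs with hone
      · rw [hone]; linarith
      · have : (e.1 1 : ℝ) + 1 ≤ r := by exact_mod_cast lt_of_le_of_ne hdigit hone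
        linarith

theorem inClosedDomain_negOne (hlam : 1 < lam) (hmul : lam * mu = -1) (hadd : lam + mu = r)
    {e : PrimarySeq lam} (he : IsAdmissible (digitsNegOne r) e.1) :
    InClosedDomain lam r r (future lam e.1) (past mu e.1) := by
  have hmu := eq_neg_inv_of_mul_eq_neg_one hlam hmul
  have hfuture := future_le_ite_eq hlam hmul hadd he
  have hpast := past_le_add_inv hlam hmul hadd he
  have hdigit : e.1 0 ≤ r := he.le 0
  rcases hdigit.eq_or_lt with heq | hlt
  · rw [if_pos heq] at hfuture
    rw [heq] at hpast
    refine ⟨hfuture.trans (inv_lt_one_of_one_lt₀ hlam).le, ⟨?_, ?_⟩, fun _ => ?_⟩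
    · linarith [neg_one_le_past hlam hmul hadd he]
    all_goals linarith
  · rw [if_neg hlt.ne] at hfuture
    have hdigit' : (e.1 0 : ℝ) + 1 ≤ r := by exact_mod_cast hlt
    refine ⟨hfuture, ⟨?_, ?_⟩, fun _ => ?_⟩
    · linarith [neg_one_le_past hlam hmul hadd he]
    all_goals linarith

theorem inDomain_step_negOne (hlam : 1 < lam) (hmul : lam * mu = -1) (hadd : lam + mu = r)
    {x y : ℝ} {k : ℤ} (h : InDomain lam r r x y) (hk : (k : ℝ) < lam * x)
    (hk' : lam * x < k + 1) : InDomain lam r r (lam * x - k) (mu * y + k) := by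
  have hneg : mu < 0 := by nlinarith
  have hgt : -1 < mu := by nlinarith
  obtain ⟨⟨hx0, hx1⟩, ⟨hy0, hy1⟩, hne, himp⟩ := h
  have hk0 : 0 ≤ k := Int.lt_add_one_iff.1 (by exact_mod_cast (by nlinarith : (0 : ℝ) < k + 1))
  have hkr : k ≤ r := Int.lt_add_one_iff.1 (by exact_mod_cast (by nlinarith : (k : ℝ) < r + 1))
  have hk0' : (0 : ℝ) ≤ k := by exact_mod_cast hk0
  rcases hne.lt_or_gt with hlow | hhigh
  · have hup : mu * y < -mu := by nlinarith
    have hlow : -1 - mu < mu * y := by nlinarith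
    rcases hkr.lt_or_eq with hkr | hkr
    · have hdigit : (k : ℝ) + 1 ≤ r := by exact_mod_cast hkr
      exact ⟨⟨by linarith, by linarith⟩, ⟨by linarith, by linarith⟩, by linarith,
        fun h => by linarith⟩
    · have hdigit : (k : ℝ) = r := by exact_mod_cast hkr
      exact ⟨⟨by linarith, by linarith⟩, ⟨by linarith, by linarith⟩, by linarith,
        fun _ => by nlinarith⟩
  · have hx := himp hhigh
    obtain rfl : k = 0 :=
      le_antisymm (Int.lt_add_one_iff.1 (by exact_mod_cast (by nlinarith : (k : ℝ) < 0 + 1))) hk0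
    have hup : mu * y < -1 - mu := by nlinarith
    have hlow : -1 < mu * y := by nlinarith
    push_cast at *
    exact ⟨⟨by linarith, by linarith⟩, ⟨by linarith, by linarith⟩, by linarith,
      fun h => by linarith⟩

theorem ne_zero_of_mul_eq_neg_one (hlam : 1 < lam) (hmul : lam * mu = -1)
    (hadd : lam + mu = r) : r ≠ 0 := by
  rintro rfl
  push_cast at hadd
  nlinarith

/-- The finite sequences `r • single 2 + single 3` and `single 1` have the same value because
`λ ^ (-1) = r λ ^ (-2) + λ ^ (-3)`. -/
theorem hasFiniteCollision_negOne (hlam : 1 < lam) (hmul : lam * mu = -1) (hadd : lam + mu = r)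
    {f : ℕ → ℕ} (hf : ∃ᶠ n in Filter.atTop, f n ≠ 0) (h : r < f 0 ∨ f 0 = r ∧ 0 < f 1) :
    HasFiniteCollision lam mu f := by
  have hr := ne_zero_of_mul_eq_neg_one hlam hmul hadd
  have hdigit : r ≤ f 0 := by omega
  have hg : IsFinite (r • single lam 2 + single lam 3) :=
    ((isFinite_single 2).nsmul r).add (isFinite_single 3)
  have hg_apply (m : ℤ) : (r • single lam 2 + single lam 3).1 m =
      (if m = 2 then r else 0) + if m = 3 then 1 else 0 := by
    rw [add_apply, nsmul_apply, single_apply, single_apply, mul_ite, mul_one, mul_zero]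
  refine ⟨r • single lam 2 + single lam 3, single lam 1, hg, isFinite_single 1, fun h => ?_,
    fun k => ?_, fun k => ?_, ?_, ?_⟩
  · simpa [hg_apply, single_apply] using congrArg (fun e => e.1 1) h
  · by_cases hzero : tail (r • single lam 2 + single lam 3) k 0 < f 0
    · exact lexLess_of_apply_zero_lt hzero
    · refine hg.lexLess_of_tail_le hf fun n => ?_
      simp only [tail, hg_apply] at hzero ⊢
      rcases n with _ | _ | n <;> split_ifs at hzero ⊢ <;> push_cast at * <;> omega
  · by_cases hzero : tail (single lam 1) k 0 < f 0
    · exact lexLess_of_apply_zero_lt hzero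
    · refine (isFinite_single 1).lexLess_of_tail_le hf fun n => ?_
      simp only [tail, single_apply] at hzero ⊢
      rcases n with _ | n <;> split_ifs at hzero ⊢ <;> push_cast at * <;> omega
  · rw [future_add hlam]
    simp only [future, weightedSum_nsmul, weightedSum_single, futureWeight]
    norm_num
    have hsq : lam ^ 2 = r * lam + 1 := by linear_combination lam * hadd - hmul
    field_simp
    linear_combination -hsq
  · rw [past_eq_zero, past_eq_zero]
    · intro n hn
      rw [single_apply, if_neg (by omega)]
    · intro n hn
      rw [hg_apply, if_neg (by omega), if_neg (by omega)]

theorem numeration_negOne (hlam : 1 < lam) (hmul : lam * mu = -1) (hadd : lam + mu = r) :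
    Numeration lam mu r r (digitsNegOne r) fun i => if Even i then 1 else lam⁻¹ where
  one_lt := hlam
  add_eq := hadd
  norm_unit := ⟨-1, by norm_num, by simpa using hmul⟩
  abs_conj := abs_eq_inv_of_mul_eq_neg_one hlam hmul
  digit_zero := by simp [digitsNegOne]
  value_zero := by simp
  value_succ i := by
    have hmu := eq_neg_inv_of_mul_eq_neg_one hlam hmul
    rcases i.even_or_odd with heven | hodd
    · rw [if_neg (by simpa [Nat.even_add_one] using heven), if_pos heven, digitsNegOne,
        if_pos heven]
      linarith
    · rw [if_pos hodd.add_one, if_neg (by simpa using hodd), digitsNegOne,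
        if_neg (by simpa using hodd), mul_inv_cancel₀ (by positivity), Nat.cast_zero, sub_zero]
  value_pos i := by split_ifs <;> positivity
  value_le i := by split_ifs <;> linarith [inv_lt_one_of_one_lt₀ hlam]
  digit_lt := by nlinarith
  lt_digit := by nlinarith
  conj_lt := by nlinarith [(Nat.cast_nonneg r : (0 : ℝ) ≤ r)]
  region _ he := inClosedDomain_negOne hlam hmul hadd he
  step _ _ _ := inDomain_step_negOne hlam hmul hadd
  collision f hlex hf := by
    obtain ⟨m, hm⟩ := exists_of_lexLess_digitsNegOne hlex
    rw [← Filter.map_add_atTop_eq_nat m, Filter.frequently_map] at hf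
    exact ⟨m, hasFiniteCollision_negOne hlam hmul hadd hf (by simpa [add_comm] using hm)⟩

end NormNegOne

/-! ### Units of norm `1` -/

section NormOne

/-- The quasi-greedy expansion `s + 1, s, s, …` of `1` in the base `λ` with
`λ ^ 2 = (s + 2) λ - 1`. -/
def digitsOne (s : ℕ) (i : ℕ) : ℕ := if i = 0 then s + 1 else s

/-- The nonpositive positions end with the word `(s + 1) s ⋯ s`, that is, with a nonempty prefix of
the expansion of `1`. -/
def EndsCritical (s : ℕ) (e : ℤ → ℕ) : Prop :=
  ∃ j : ℕ, e (-j) = s + 1 ∧ ∀ i < j, e (-i) = s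

variable {lam mu : ℝ} {s : ℕ}

theorem IsAdmissible.le_of_endsCritical {e : ℤ → ℕ} (h : IsAdmissible (digitsOne s) e)
    (hcrit : EndsCritical s e) : e 1 ≤ s := by
  by_contra! hlt
  obtain ⟨j, hj, hlast⟩ := hcrit
  refine h (-j) ⟨j + 1, fun k hk => ?_, ?_⟩
  · rcases k with _ | k
    · simp [digitsOne, hj]
    · rw [digitsOne, if_neg k.succ_ne_zero, ← hlast (j - (k + 1)) (by omega)]
      congr 1
      omega
  · rw [digitsOne, if_neg j.succ_ne_zero]
    simpa using hlt

theorem endsCritical_shift {e : PrimarySeq lam} :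
    EndsCritical s (shift e).1 ↔ e.1 1 = s + 1 ∨ e.1 1 = s ∧ EndsCritical s e.1 := by
  simp only [EndsCritical, shift_apply]
  constructor
  · rintro ⟨_ | j, hj, hlast⟩
    · exact Or.inl (by simpa using hj)
    · exact Or.inr ⟨by simpa using hlast 0 (by omega), j, by simpa using hj,
        fun i hi => by simpa using hlast (i + 1) (by omega)⟩
  · rintro (h | ⟨h, j, hj, hlast⟩)
    · exact ⟨0, by simpa using h, by simp⟩
    · refine ⟨j + 1, by simpa using hj, fun i hi => ?_⟩
      rcases i with _ | i
      · simpa using h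
      · simpa using hlast i (by omega)

theorem abs_eq_inv_of_mul_eq_one (hlam : 1 < lam) (hmul : lam * mu = 1) : |mu| = lam⁻¹ := by
  rw [eq_inv_of_mul_eq_one_right hmul, abs_of_pos (by positivity)]

open scoped Classical in
theorem past_le_ite_endsCritical (hlam : 1 < lam) (hmul : lam * mu = 1)
    (hadd : lam + mu = s + 2) {e : PrimarySeq lam} (he : e ∈ admissibleSet lam (digitsOne s)) :
    past mu e.1 ≤ if EndsCritical s e.1 then lam else lam - 1 := by
  have hmu : mu = lam⁻¹ := eq_inv_of_mul_eq_one_right hmul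
  have hmu0 : 0 < mu := by rw [hmu]; positivity
  have habs := abs_eq_inv_of_mul_eq_one hlam hmul
  refine le_of_contraction (F := fun e : PrimarySeq lam => past mu e.1)
    (b := fun e => if EndsCritical s e.1 then lam else lam - 1) hlam ?_
    (fun c _ hbound e he => ?_) he
  · refine ⟨_, fun e he => (le_abs_self _).trans (((isDominated_pastWeight habs).abs_weightedSum_le
      hlam fun n => he.le n).trans (le_add_of_nonneg_left ?_))⟩
    split_ifs <;> linarith
  · obtain ⟨e, he', rfl⟩ := IsAdmissible.exists_shift_eq hlam he
    have hmu1 : mu < 1 := hmu ▸ inv_lt_one_of_one_lt₀ hlam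
    have hprev := mul_le_mul_of_nonneg_left (hbound e he') hmu0.le
    have hcrit := he'.le_of_endsCritical
    have hdigit : e.1 1 ≤ s + 1 := he'.le 1
    rw [past_shift hlam habs, endsCritical_shift, div_eq_inv_mul, ← hmu]
    rcases hdigit.eq_or_lt with heq | hlt
    · rw [if_neg fun h => by have := hcrit h; omega] at hprev
      rw [if_pos (Or.inl heq), heq]
      push_cast
      linarith
    rcases (Nat.lt_succ_iff.1 hlt).eq_or_lt with heq | hlt
    · simp only [heq, true_and, Nat.left_eq_add, one_ne_zero, false_or]
      split_ifs at hprev ⊢ <;> nlinarith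
    · have hdigit' : (e.1 1 : ℝ) + 1 ≤ s := by exact_mod_cast hlt
      rw [if_neg (show ¬(e.1 1 = s + 1 ∨ e.1 1 = s ∧ EndsCritical s e.1) by omega)]
      split_ifs at hprev <;> nlinarith

open scoped Classical in
theorem future_le_ite_endsCritical (hlam : 1 < lam) (hmul : lam * mu = 1)
    (hadd : lam + mu = s + 2) {e : PrimarySeq lam} (he : e ∈ admissibleSet lam (digitsOne s)) :
    future lam e.1 ≤ if EndsCritical s e.1 then 1 - mu else 1 := by
  have hmu0 : 0 < mu := pos_of_mul_pos_right (by simp [hmul]) (zero_lt_one.trans hlam).le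
  have hmu1 : mu < 1 := by nlinarith
  refine le_of_contraction (F := fun e : PrimarySeq lam => future lam e.1)
    (b := fun e => if EndsCritical s e.1 then 1 - mu else 1) hlam ?_
    (fun c _ hbound e he => ?_) he
  · refine ⟨_, fun e he => (le_abs_self _).trans (((isDominated_futureWeight
      (by positivity)).abs_weightedSum_le hlam fun n => he.le n).trans
      (le_add_of_nonneg_left ?_))⟩
    split_ifs <;> linarith
  · have hnext := hbound (shift e) (isAdmissible_shift.2 he)
    have hcrit := he.le_of_endsCritical
    have hdigit : e.1 1 ≤ s + 1 := he.le 1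
    rw [future_shift hlam, endsCritical_shift, sub_le_iff_le_add] at hnext
    refine le_of_mul_le_mul_left (hnext.trans ?_) (by positivity : 0 < lam)
    rw [mul_add, mul_div_cancel₀ c (by positivity)]
    rcases hdigit.eq_or_lt with heq | hlt
    · rw [if_pos (Or.inl heq), if_neg fun h => by have := hcrit h; omega, heq]
      push_cast
      linarith
    rcases (Nat.lt_succ_iff.1 hlt).eq_or_lt with heq | hlt
    · simp only [heq, true_and, Nat.left_eq_add, one_ne_zero, false_or]
      split_ifs <;> linarith
    · have hdigit' : (e.1 1 : ℝ) + 1 ≤ s := by exact_mod_cast hlt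
      rw [if_neg (show ¬(e.1 1 = s + 1 ∨ e.1 1 = s ∧ EndsCritical s e.1) by omega)]
      split_ifs <;> linarith

theorem past_nonneg (hmu : 0 ≤ mu) (e : ℤ → ℕ) : 0 ≤ past mu e := by
  refine tsum_nonneg fun n => ?_
  rw [pastWeight]
  split_ifs <;> positivity

theorem inClosedDomain_one (hlam : 1 < lam) (hmul : lam * mu = 1) (hadd : lam + mu = s + 2)
    {e : PrimarySeq lam} (he : IsAdmissible (digitsOne s) e.1) :
    InClosedDomain lam (s + 2) (s + 1) (future lam e.1) (past mu e.1) := by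
  have hmu0 : 0 < mu := pos_of_mul_pos_right (by simp [hmul]) (zero_lt_one.trans hlam).le
  have hfuture := future_le_ite_endsCritical hlam hmul hadd he
  have hpast := past_le_ite_endsCritical hlam hmul hadd he
  have hpast0 := past_nonneg hmu0.le e.1
  rw [InClosedDomain]
  push_cast
  split_ifs at hfuture hpast <;>
    exact ⟨by linarith, ⟨by linarith, by linarith⟩, fun _ => by linarith⟩

theorem inDomain_step_one (hlam : 1 < lam) (hmul : lam * mu = 1) (hadd : lam + mu = s + 2)
    {x y : ℝ} {k : ℤ} (h : InDomain lam (s + 2) (s + 1) x y) (hk : (k : ℝ) < lam * x)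
    (hk' : lam * x < k + 1) : InDomain lam (s + 2) (s + 1) (lam * x - k) (mu * y + k) := by
  have hmu0 : 0 < mu := pos_of_mul_pos_right (by simp [hmul]) (zero_lt_one.trans hlam).le
  obtain ⟨⟨hx0, hx1⟩, ⟨hy0, hy1⟩, hne, himp⟩ := h
  rw [InDomain]
  push_cast at *
  have hk0 : 0 ≤ k := Int.lt_add_one_iff.1 (by exact_mod_cast (by nlinarith : (0 : ℝ) < k + 1))
  have hk0' : (0 : ℝ) ≤ k := by exact_mod_cast hk0
  have hy0' : 0 < mu * y := mul_pos hmu0 (by linarith)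
  rcases hne.lt_or_gt with hlow | hhigh
  · have hup : mu * y < 1 - mu := by nlinarith
    have hks : k ≤ s + 1 :=
      Int.lt_add_one_iff.1 (by exact_mod_cast (by nlinarith : (k : ℝ) < s + 1 + 1))
    rcases hks.lt_or_eq with hlt | heq
    · have hdigit : (k : ℝ) + 1 ≤ s + 1 := by exact_mod_cast hlt
      exact ⟨⟨by linarith, by linarith⟩, ⟨by linarith, by linarith⟩, by linarith,
        fun h => by linarith⟩
    · have hdigit : (k : ℝ) = s + 1 := by exact_mod_cast heq
      exact ⟨⟨by linarith, by linarith⟩, ⟨by linarith, by linarith⟩, by linarith,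
        fun _ => by nlinarith⟩
  · have hx := himp hhigh
    have hup : mu * y < 1 := by nlinarith
    have hlow : 1 - mu < mu * y := by nlinarith
    have hlx : lam * x < lam - 1 := by nlinarith
    have hks : k ≤ s :=
      Int.lt_add_one_iff.1 (by exact_mod_cast (by linarith : (k : ℝ) < s + 1))
    rcases hks.lt_or_eq with hlt | heq
    · have hdigit : (k : ℝ) + 1 ≤ s := by exact_mod_cast hlt
      exact ⟨⟨by linarith, by linarith⟩, ⟨by linarith, by linarith⟩, by linarith,
        fun h => by linarith⟩
    · have hdigit : (k : ℝ) = s := by exact_mod_cast heq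
      exact ⟨⟨by linarith, by linarith⟩, ⟨by linarith, by linarith⟩, by linarith,
        fun _ => by linarith⟩

/-- The finite sequence with the word `(s + 1) s ⋯ s (s + 1)` in the positions `2, …, j + 3`. -/
def criticalSeq (lam : ℝ) (s j : ℕ) : PrimarySeq lam :=
  single lam 2 + single lam (j + 3) + s • ∑ i ∈ Finset.range (j + 2), single lam (i + 2)

theorem sum_single_apply (j : ℕ) (m : ℤ) :
    (∑ i ∈ Finset.range j, single lam (i + 2)).1 m = if 2 ≤ m ∧ m < j + 2 then 1 else 0 := by
  induction j with
  | zero => simp; omega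
  | succ j ih =>
    rw [Finset.sum_range_succ, add_apply, ih, single_apply]
    split_ifs <;> push_cast at * <;> omega

theorem criticalSeq_apply (j : ℕ) (m : ℤ) : (criticalSeq lam s j).1 m =
    (if m = 2 then 1 else 0) + (if m = j + 3 then 1 else 0) +
      if 2 ≤ m ∧ m < j + 4 then s else 0 := by
  rw [criticalSeq, add_apply, add_apply, nsmul_apply, sum_single_apply, single_apply,
    single_apply, mul_ite, mul_one, mul_zero]
  push_cast
  ring_nf

theorem isFinite_criticalSeq (j : ℕ) : IsFinite (criticalSeq lam s j) := by
  refine (Set.finite_Icc 2 ((j : ℤ) + 3)).subset fun m hm => ?_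
  contrapose! hm
  rw [Set.mem_Icc] at hm
  rw [Function.notMem_support, criticalSeq_apply, if_neg (by omega), if_neg (by omega),
    if_neg (by omega)]
  rfl

theorem future_single {n : ℕ} (hn : 0 < n) : future lam (single lam n).1 = lam⁻¹ ^ n := by
  rw [future, weightedSum_single, futureWeight, if_pos (by exact_mod_cast hn), zpow_neg,
    zpow_natCast, inv_pow]

theorem future_criticalSeq (hlam : 1 < lam) (hmul : lam * mu = 1) (hadd : lam + mu = s + 2)
    (j : ℕ) : future lam (criticalSeq lam s j).1 = lam⁻¹ + lam⁻¹ ^ (j + 4) := by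
  have hmu : mu = lam⁻¹ := eq_inv_of_mul_eq_one_right hmul
  have hlam_inv : lam * lam⁻¹ = 1 := hmu ▸ hmul
  have hs : s * lam⁻¹ = (1 - lam⁻¹) ^ 2 := by
    rw [hmu] at hadd
    linear_combination -lam⁻¹ * hadd + hlam_inv
  have hsingle (i : ℕ) : future lam (single lam ((i : ℤ) + 2)).1 = lam⁻¹ ^ (i + 2) := by
    exact_mod_cast future_single (lam := lam) (n := i + 2) (by omega)
  have hsum (j : ℕ) : s * future lam (∑ i ∈ Finset.range j, single lam ((i : ℤ) + 2)).1 =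
      lam⁻¹ * (1 - lam⁻¹) * (1 - lam⁻¹ ^ j) := by
    induction j with
    | zero => simp [future, weightedSum]
    | succ j ih =>
      rw [Finset.sum_range_succ, future_add hlam, mul_add, ih, hsingle]
      linear_combination lam⁻¹ ^ (j + 1) * hs
  have htwo := hsingle 0
  have hlast := hsingle (j + 1)
  push_cast [zero_add, add_assoc] at htwo hlast
  rw [criticalSeq, future_add hlam, future_add hlam, htwo, hlast, future, weightedSum_nsmul,
    ← future]
  linear_combination hsum (j + 2)

theorem exists_of_lexLess_digitsOne {f : ℕ → ℕ} (h : LexLess (digitsOne s) f) :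
    ∃ j : ℕ, s + 2 ≤ f 0 ∨ s + 1 ≤ f 0 ∧ (∀ i ≤ j, s ≤ f i) ∧ s + 1 ≤ f (j + 1) := by
  obtain ⟨_ | j, hpre, hlt⟩ := h
  · exact ⟨0, Or.inl hlt⟩
  · have hzero : s + 1 = f 0 := hpre 0 j.succ_pos
    refine ⟨j, Or.inr ⟨hzero.le, fun i hi => ?_, by simpa [digitsOne] using hlt⟩⟩
    rw [← hpre i (Nat.lt_succ_of_le hi), digitsOne]
    split_ifs <;> omega

theorem tail_criticalSeq_lexLess {j : ℕ} {f : ℕ → ℕ} (hf : ∃ᶠ n in Filter.atTop, f n ≠ 0)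
    (h : s + 2 ≤ f 0 ∨ s + 1 ≤ f 0 ∧ (∀ i ≤ j, s ≤ f i) ∧ s + 1 ≤ f (j + 1)) (k : ℤ) :
    LexLess (tail (criticalSeq lam s j) k) f := by
  by_cases hzero : tail (criticalSeq lam s j) k 0 < f 0
  · exact lexLess_of_apply_zero_lt hzero
  · refine (isFinite_criticalSeq j).lexLess_of_tail_le hf fun n => ?_
    simp only [tail, criticalSeq_apply] at hzero ⊢
    obtain ⟨hfirst, hinit, hlast⟩ : s + 1 ≤ f 0 ∧ (∀ i ≤ j, s ≤ f i) ∧ s + 1 ≤ f (j + 1) :=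
      h.resolve_left fun h => by split_ifs at hzero <;> omega
    have hk : k = 2 ∨ k = j + 3 := by
      split_ifs at hzero <;> omega
    rcases lt_trichotomy n (j + 1) with hn | rfl | hn
    · rcases n with _ | n
      · split_ifs <;> omega
      · have := hinit (n + 1) (by omega)
        split_ifs <;> omega
    · split_ifs <;> omega
    · split_ifs <;> omega

theorem hasFiniteCollision_one (hlam : 1 < lam) (hmul : lam * mu = 1)
    (hadd : lam + mu = s + 2) {f : ℕ → ℕ} (hf : ∃ᶠ n in Filter.atTop, f n ≠ 0)
    (h : LexLess (digitsOne s) f) : HasFiniteCollision lam mu f := by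
  have hs : 0 < s := by
    have : (0 : ℝ) < s := by nlinarith [sq_pos_of_pos (sub_pos.2 hlam)]
    exact_mod_cast this
  obtain ⟨j, hj⟩ := exists_of_lexLess_digitsOne h
  have hsingle (m : ℤ) : (single lam 1 + single lam (j + 4)).1 m =
      (if m = 1 then 1 else 0) + if m = j + 4 then 1 else 0 := by
    rw [add_apply, single_apply, single_apply]
  refine ⟨criticalSeq lam s j, single lam 1 + single lam (j + 4), isFinite_criticalSeq j,
    (isFinite_single 1).add (isFinite_single _), fun heq => ?_, tail_criticalSeq_lexLess hf hj,
    fun k => lexLess_of_apply_zero_lt ?_, ?_, ?_⟩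
  · have hone := congrArg (fun e => e.1 1) heq
    simp only [hsingle, criticalSeq_apply] at hone
    split_ifs at hone <;> omega
  · simp only [tail, hsingle]
    split_ifs <;> omega
  · have hone := future_single (lam := lam) (n := 1) one_pos
    have hlast := future_single (lam := lam) (n := j + 4) (by omega)
    push_cast at hone hlast
    rw [future_criticalSeq hlam hmul hadd, future_add hlam, hone, hlast, pow_one]
  · rw [past_eq_zero, past_eq_zero]
    · intro n hn
      rw [hsingle, if_neg (by omega), if_neg (by omega)]
    · intro n hn
      rw [criticalSeq_apply, if_neg (by omega), if_neg (by omega), if_neg (by omega)]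

theorem numeration_one (hlam : 1 < lam) (hmul : lam * mu = 1) (hadd : lam + mu = s + 2) :
    Numeration lam mu (s + 2) (s + 1) (digitsOne s) fun i => if i = 0 then 1 else 1 - mu where
  one_lt := hlam
  add_eq := by exact_mod_cast hadd
  norm_unit := ⟨1, by norm_num, by simpa using hmul⟩
  abs_conj := abs_eq_inv_of_mul_eq_one hlam hmul
  digit_zero := by simp [digitsOne]
  value_zero := by simp
  value_succ i := by
    rcases i with _ | i
    · simp only [digitsOne, if_true, zero_add, one_ne_zero, if_false]
      push_cast
      linarith
    · simp only [digitsOne, Nat.add_eq_zero_iff, one_ne_zero, and_false, if_false]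
      linarith
  value_pos i := by split_ifs <;> nlinarith
  value_le i := by split_ifs <;> nlinarith
  digit_lt := by push_cast; nlinarith
  lt_digit := by push_cast; nlinarith
  conj_lt := by push_cast; nlinarith
  region _ he := inClosedDomain_one hlam hmul hadd he
  step _ _ _ := inDomain_step_one hlam hmul hadd
  collision _ hlex hf := ⟨0, hasFiniteCollision_one hlam hmul hadd hf hlex⟩

end NormOne

/-! ### Codes of the generic points -/

section FundamentalDomain

variable {κ H : ℝ}

/-- Half-open version of the L-shaped domain `[0, 1) × [0, H) ∪ [0, κ) × [H, H + 1)`, a fundamental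
domain of the lattice spanned by `(1, -1)` and `(κ, H)`. -/
def InLShape (κ H x y : ℝ) : Prop :=
  (0 ≤ x ∧ x < 1) ∧ 0 ≤ y ∧ y < H + if x < κ then 1 else 0

/-- The ordinate of the translate of `(x, y)` by `n (κ, H)` and by the multiple of `(1, -1)` which
moves the abscissa to `[0, 1)`. -/
def tileHeight (κ H x y : ℝ) (n : ℤ) : ℝ := y + ⌊x + n * κ⌋ + n * H

theorem strictMono_tileHeight (hκ : 0 ≤ κ) (hH : 0 < H) (x y : ℝ) :
    StrictMono (tileHeight κ H x y) := by
  intro m n hmn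
  have hmn' : (m : ℝ) < n := by exact_mod_cast hmn
  have hfloor : (⌊x + m * κ⌋ : ℝ) ≤ ⌊x + n * κ⌋ := by
    exact_mod_cast Int.floor_le_floor (by gcongr)
  have hH' : m * H < n * H := by gcongr
  rw [tileHeight, tileHeight]
  linarith

theorem floor_sub_eq (hκ0 : 0 < κ) (hκ1 : κ < 1) (a : ℝ) :
    (⌊a - κ⌋ : ℝ) = ⌊a⌋ - if a - ⌊a⌋ < κ then 1 else 0 := by
  have hle := Int.floor_le a
  have hlt := Int.lt_floor_add_one a
  split_ifs with h
  · have : ⌊a - κ⌋ = ⌊a⌋ - 1 := by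
      rw [Int.floor_eq_iff]; push_cast; constructor <;> linarith
    exact_mod_cast this
  · have : ⌊a - κ⌋ = ⌊a⌋ := by
      rw [Int.floor_eq_iff]; constructor <;> linarith
    rw [this, sub_zero]

theorem inLShape_iff (hκ0 : 0 < κ) (hκ1 : κ < 1) {x y : ℝ} {m n : ℤ} :
    InLShape κ H (x + m + n * κ) (y - m + n * H) ↔
      m = -⌊x + n * κ⌋ ∧ tileHeight κ H x y (n - 1) < 0 ∧ 0 ≤ tileHeight κ H x y n := by
  have hfloor := floor_sub_eq hκ0 hκ1 (x + n * κ)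
  have hpred : x + ((n - 1 : ℤ) : ℝ) * κ = x + n * κ - κ := by push_cast; ring
  have habscissa (h : m = -⌊x + n * κ⌋) :
      x + m + n * κ = x + n * κ - ⌊x + n * κ⌋ := by rw [h]; push_cast; ring
  have hm : (0 ≤ x + m + n * κ ∧ x + m + n * κ < 1) ↔ m = -⌊x + n * κ⌋ := by
    rw [← neg_eq_iff_eq_neg, eq_comm (a := -m), Int.floor_eq_iff]
    push_cast
    constructor <;> rintro ⟨h, h'⟩ <;> constructor <;> linarith
  rw [InLShape, hm, tileHeight, tileHeight, hpred, hfloor]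
  refine and_congr_right fun h => ?_
  rw [habscissa h, h, and_comm]
  push_cast
  refine and_congr ?_ ?_ <;> constructor <;> intro <;> linarith

theorem exists_tileHeight (hκ : 0 ≤ κ) (hH : 0 < H) (x y : ℝ) :
    ∃ n : ℤ, tileHeight κ H x y (n - 1) < 0 ∧ 0 ≤ tileHeight κ H x y n := by
  have hpos : 0 < κ + H := by positivity
  obtain ⟨N, hN, hmax⟩ := Int.exists_greatest_of_bdd
    (P := fun n : ℤ => tileHeight κ H x y n < 0)
    ⟨⌈(1 - x - y) / (κ + H)⌉, fun n hn => by
      have hfloor := Int.lt_floor_add_one (x + n * κ)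
      rw [tileHeight] at hn
      have hlt : (n : ℝ) < (1 - x - y) / (κ + H) := by
        rw [lt_div_iff₀ hpos]
        linarith
      exact_mod_cast hlt.le.trans (Int.le_ceil _)⟩
    ⟨⌊-(x + y) / (κ + H)⌋ - 1, by
      have hdiv := Int.floor_le (-(x + y) / (κ + H))
      rw [le_div_iff₀ hpos] at hdiv
      have hfloor := Int.floor_le (x + ((⌊-(x + y) / (κ + H)⌋ - 1 : ℤ) : ℝ) * κ)
      rw [tileHeight]
      push_cast at hfloor ⊢
      linarith⟩
  exact ⟨N + 1, by simpa using hN, not_lt.1 fun h => by have := hmax _ h; omega⟩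

theorem exists_inLShape (hκ0 : 0 < κ) (hκ1 : κ < 1) (hH : 0 < H) (x y : ℝ) :
    ∃ m n : ℤ, InLShape κ H (x + m + n * κ) (y - m + n * H) := by
  obtain ⟨n, hn⟩ := exists_tileHeight hκ0.le hH x y
  exact ⟨_, n, (inLShape_iff hκ0 hκ1).2 ⟨rfl, hn⟩⟩

theorem InLShape.eq_zero (hκ0 : 0 < κ) (hκ1 : κ < 1) (hH : 0 < H) {x y : ℝ} {m n : ℤ}
    (h : InLShape κ H x y) (h' : InLShape κ H (x + m + n * κ) (y - m + n * H)) :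
    m = 0 ∧ n = 0 := by
  have hmono := strictMono_tileHeight hκ0.le hH x y
  obtain ⟨hm, hprev, hn⟩ := (inLShape_iff hκ0 hκ1).1 h'
  obtain ⟨hm', hprev', hn'⟩ := (inLShape_iff (m := 0) (n := 0) hκ0 hκ1).1 (by simpa using h)
  have hlt := hmono.lt_iff_lt.1 (hprev.trans_le hn')
  have hlt' := hmono.lt_iff_lt.1 (hprev'.trans_le hn)
  obtain rfl : n = 0 := by omega
  exact ⟨hm.trans hm'.symm, rfl⟩

end FundamentalDomain

theorem transcendental_of_eq_mul_add {x z a b : ℝ} (hx : Transcendental ℚ x)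
    (ha : IsAlgebraic ℚ a) (hb : IsAlgebraic ℚ b) (h : x = a * z + b) : Transcendental ℚ z :=
  fun hz => hx (h ▸ (ha.mul hz).add hb)

theorem transcendental_zpow_mul {x a : ℝ} (hx : Transcendental ℚ x) (ha : IsAlgebraic ℚ a)
    (ha0 : a ≠ 0) (n : ℤ) : Transcendental ℚ (a ^ n * x) := by
  have hpow : IsAlgebraic ℚ (a ^ n) := by
    cases n with
    | ofNat n => simpa using ha.pow n
    | negSucc n => simpa only [zpow_negSucc] using (ha.pow _).inv
  exact transcendental_of_eq_mul_add hx hpow.inv isAlgebraic_zero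
    (by rw [inv_mul_cancel_left₀ (zpow_ne_zero n ha0), add_zero])

theorem ne_of_transcendental {x a : ℝ} (hx : Transcendental ℚ x) (ha : IsAlgebraic ℚ a) :
    x ≠ a := by
  rintro rfl
  exact hx ha

theorem eq_zero_of_bounded_of_expanding {E : Type*} [NormedAddCommGroup E] {lam B : ℝ}
    (hlam : 1 < lam) {f : ℕ → E} (hf : ∀ n, ‖f (n + 1)‖ = lam * ‖f n‖) (hB : ∀ n, ‖f n‖ ≤ B) :
    f 0 = 0 := by
  have hpow (n : ℕ) : ‖f n‖ = lam ^ n * ‖f 0‖ := by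
    induction n with
    | zero => simp
    | succ n ih => rw [hf, ih]; ring
  by_contra hne
  have hpos : 0 < ‖f 0‖ := norm_pos_iff.2 hne
  obtain ⟨n, hn⟩ := pow_unbounded_of_one_lt (B / ‖f 0‖) hlam
  rw [div_lt_iff₀ hpos, ← hpow] at hn
  exact (hB n).not_gt hn

/-- The translate by `m` of a bounded sequence. -/
def translate {lam : ℝ} (hlam : 1 < lam) (e : ℤ → ℕ) {c : ℕ} (he : ∀ n, e n ≤ c) (m : ℤ) :
    PrimarySeq lam :=
  ofBounded hlam (fun n => e (n + m)) c fun _ => he _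

theorem shift_translate {lam : ℝ} (hlam : 1 < lam) (e : ℤ → ℕ) {c : ℕ} (he : ∀ n, e n ≤ c)
    (m : ℤ) : shift (translate hlam e he m) = translate hlam e he (m + 1) := by
  apply Subtype.ext
  ext n
  simp only [shift_apply, translate, ofBounded]
  ring_nf

namespace Numeration

variable {lam mu : ℝ} {r c : ℕ} {d : ℕ → ℕ} {D : ℕ → ℝ}

theorem lam_pos (hN : Numeration lam mu r c d D) : 0 < lam := zero_lt_one.trans hN.one_lt

theorem mu_ne_zero (hN : Numeration lam mu r c d D) : mu ≠ 0 :=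
  abs_pos.1 (hN.abs_conj ▸ inv_pos.2 hN.lam_pos)

theorem isAlgebraic_lam (hN : Numeration lam mu r c d D) : IsAlgebraic ℚ lam := by
  obtain ⟨s, -, hs⟩ := hN.norm_unit
  refine ⟨Polynomial.X ^ 2 - (Polynomial.C (r : ℚ) * Polynomial.X - Polynomial.C (s : ℚ)), ?_, ?_⟩
  · refine (Polynomial.monic_X_pow_sub ?_).ne_zero
    exact (Polynomial.degree_sub_le _ _).trans_lt (max_lt
      ((Polynomial.degree_C_mul_X_le _).trans_lt (by norm_num))
      (Polynomial.degree_C_le.trans_lt (by norm_num)))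
  · simp only [map_sub, map_pow, map_mul, Polynomial.aeval_X, map_natCast, map_intCast]
    linear_combination lam * hN.add_eq - hs

theorem isAlgebraic_mu (hN : Numeration lam mu r c d D) : IsAlgebraic ℚ mu := by
  rw [show mu = r - lam by linarith [hN.add_eq]]
  exact (isAlgebraic_natCast r).sub hN.isAlgebraic_lam

theorem transcendental_add (hN : Numeration lam mu r c d D) {x : ℝ} (hx : Transcendental ℚ x)
    (p q : ℤ) : Transcendental ℚ (x + (p + q * lam)) :=
  transcendental_of_eq_mul_add hx isAlgebraic_one
    ((isAlgebraic_intCast p).add ((isAlgebraic_intCast q).mul hN.isAlgebraic_lam)).neg (by ring)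

theorem transcendental_sub (hN : Numeration lam mu r c d D) {y : ℝ} (hy : Transcendental ℚ y)
    (p q : ℤ) : Transcendental ℚ (y - (p + q * mu)) :=
  transcendental_of_eq_mul_add hy isAlgebraic_one
    ((isAlgebraic_intCast p).add ((isAlgebraic_intCast q).mul hN.isAlgebraic_mu)) (by ring)

theorem inDomain_iff_inLShape (hN : Numeration lam mu r c d D) {x y : ℝ}
    (hx : x ≠ 0) (hy : Transcendental ℚ y) :
    InDomain lam r c x y ↔ InLShape (lam - c) (c - mu) x (y - (r - 1 - c)) := by
  have hadd := hN.add_eq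
  have hlow : y ≠ (r : ℝ) - 1 - c := ne_of_transcendental hy
    (((isAlgebraic_natCast r).sub isAlgebraic_one).sub (isAlgebraic_natCast c))
  have hmid : y ≠ lam - 1 := ne_of_transcendental hy (hN.isAlgebraic_lam.sub isAlgebraic_one)
  constructor
  · rintro ⟨⟨hx0, hx1⟩, ⟨hy0, hy1⟩, -, himp⟩
    refine ⟨⟨hx0.le, hx1⟩, by linarith, ?_⟩
    split_ifs with h
    · linarith
    · linarith [lt_of_le_of_ne (not_lt.1 fun hlt => h (himp hlt)) hmid]
  · rintro ⟨⟨hx0, hx1⟩, hy0, hy1⟩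
    refine ⟨⟨hx0.lt_of_ne' hx, hx1⟩, ⟨lt_of_le_of_ne (by linarith) hlow.symm, ?_⟩, hmid, ?_⟩
    · split_ifs at hy1 <;> linarith
    · intro h
      by_contra hn
      rw [if_neg hn] at hy1
      linarith

theorem exists_inDomain (hN : Numeration lam mu r c d D) {x y : ℝ} (hx : Transcendental ℚ x)
    (hy : Transcendental ℚ y) :
    ∃ p q : ℤ, InDomain lam r c (x + (p + q * lam)) (y - (p + q * mu)) := by
  obtain ⟨m, n, h⟩ := exists_inLShape (κ := lam - c) (H := c - mu) (sub_pos.2 hN.digit_lt)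
    (by linarith [hN.lt_digit]) (sub_pos.2 hN.conj_lt) x (y - (r - 1 - c))
  refine ⟨m - n * c, n, (hN.inDomain_iff_inLShape (ne_of_transcendental
    (hN.transcendental_add hx _ _) isAlgebraic_zero) (hN.transcendental_sub hy _ _)).2 ?_⟩
  convert h using 1 <;> push_cast <;> ring

theorem eq_of_inDomain (hN : Numeration lam mu r c d D) {x y x' y' : ℝ} {p q : ℤ}
    (hyt : Transcendental ℚ y) (h : InDomain lam r c x y) (h' : InDomain lam r c x' y')
    (hx : x' = x + (p + q * lam)) (hy : y' = y - (p + q * mu)) : x = x' ∧ y = y' := by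
  subst hx hy
  have hL := (hN.inDomain_iff_inLShape h.1.1.ne' hyt).1 h
  have hL' := (hN.inDomain_iff_inLShape h'.1.1.ne' (hN.transcendental_sub hyt p q)).1 h'
  obtain ⟨hp, rfl⟩ := hL.eq_zero (m := p + q * c) (n := q) (sub_pos.2 hN.digit_lt)
    (by linarith [hN.lt_digit]) (sub_pos.2 hN.conj_lt)
    (by convert hL' using 1 <;> push_cast <;> ring)
  obtain rfl : p = 0 := by simpa using hp
  simp

theorem inDomain_of_isAdmissible (hN : Numeration lam mu r c d D) {e : PrimarySeq lam}
    (he : IsAdmissible d e.1) (hx : Transcendental ℚ (future lam e.1))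
    (hy : Transcendental ℚ (past mu e.1)) : InDomain lam r c (future lam e.1) (past mu e.1) := by
  obtain ⟨hx1, ⟨hy0, hy1⟩, himp⟩ := hN.region e he
  have hr := isAlgebraic_natCast (R := ℚ) (A := ℝ) r
  have hc := isAlgebraic_natCast (R := ℚ) (A := ℝ) c
  exact ⟨⟨(future_nonneg hN.lam_pos _).lt_of_ne' (ne_of_transcendental hx isAlgebraic_zero),
      hx1.lt_of_ne (ne_of_transcendental hx isAlgebraic_one)⟩,
    ⟨hy0.lt_of_ne' (ne_of_transcendental hy ((hr.sub isAlgebraic_one).sub hc)),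
      hy1.lt_of_ne (ne_of_transcendental hy hN.isAlgebraic_lam)⟩,
    ne_of_transcendental hy (hN.isAlgebraic_lam.sub isAlgebraic_one),
    fun h => (himp h).lt_of_ne (ne_of_transcendental hx (hN.isAlgebraic_lam.sub hc))⟩

theorem transcendental_future_shift (hN : Numeration lam mu r c d D) {e : PrimarySeq lam} :
    Transcendental ℚ (future lam (shift e).1) ↔ Transcendental ℚ (future lam e.1) := by
  have hlam := hN.isAlgebraic_lam
  have hdigit := isAlgebraic_natCast (R := ℚ) (A := ℝ) (e.1 1)
  have hlam0 := hN.lam_pos.ne'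
  rw [future_shift hN.one_lt]
  exact ⟨fun h => transcendental_of_eq_mul_add h hlam hdigit.neg (by ring), fun h =>
    transcendental_of_eq_mul_add h hlam.inv (hlam.inv.mul hdigit) (by field_simp; ring)⟩

theorem transcendental_past_shift (hN : Numeration lam mu r c d D) {e : PrimarySeq lam} :
    Transcendental ℚ (past mu (shift e).1) ↔ Transcendental ℚ (past mu e.1) := by
  have hmu := hN.isAlgebraic_mu
  have hdigit := isAlgebraic_natCast (R := ℚ) (A := ℝ) (e.1 1)
  have hmu0 := hN.mu_ne_zero
  rw [past_shift hN.one_lt hN.abs_conj]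
  exact ⟨fun h => transcendental_of_eq_mul_add h hmu hdigit (by ring), fun h =>
    transcendental_of_eq_mul_add h hmu.inv (hmu.inv.mul hdigit).neg (by field_simp; ring)⟩

theorem value_shift_eq (hN : Numeration lam mu r c d D) {e e' : PrimarySeq lam}
    (he : IsAdmissible d e.1) (he' : IsAdmissible d e'.1)
    (hx : Transcendental ℚ (future lam e.1)) (hy : Transcendental ℚ (past mu e.1))
    (hfuture : future lam e.1 = future lam e'.1) (hpast : past mu e.1 = past mu e'.1) :
    future lam (shift e).1 = future lam (shift e').1 ∧
      past mu (shift e).1 = past mu (shift e').1 := by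
  have hxs := hN.transcendental_future_shift.2 hx
  have hys := hN.transcendental_past_shift.2 hy
  refine hN.eq_of_inDomain (p := e.1 1 - e'.1 1) (q := 0) hys
    (hN.inDomain_of_isAdmissible (isAdmissible_shift.2 he) hxs hys)
    (hN.inDomain_of_isAdmissible (isAdmissible_shift.2 he')
      (hN.transcendental_future_shift.2 (hfuture ▸ hx))
      (hN.transcendental_past_shift.2 (hpast ▸ hy))) ?_ ?_
  · rw [future_shift hN.one_lt, future_shift hN.one_lt, hfuture]
    push_cast
    ring
  · rw [past_shift hN.one_lt hN.abs_conj, past_shift hN.one_lt hN.abs_conj, hpast]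
    push_cast
    ring

theorem value_eq_of_value_shift_eq (hN : Numeration lam mu r c d D) {e e' : PrimarySeq lam}
    (he : IsAdmissible d e.1) (he' : IsAdmissible d e'.1)
    (hx : Transcendental ℚ (future lam e.1)) (hy : Transcendental ℚ (past mu e.1))
    (hfuture : future lam (shift e).1 = future lam (shift e').1)
    (hpast : past mu (shift e).1 = past mu (shift e').1) :
    future lam e.1 = future lam e'.1 ∧ past mu e.1 = past mu e'.1 := by
  have hx' : Transcendental ℚ (future lam e'.1) :=
    hN.transcendental_future_shift.1 (hfuture ▸ hN.transcendental_future_shift.2 hx)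
  have hy' : Transcendental ℚ (past mu e'.1) :=
    hN.transcendental_past_shift.1 (hpast ▸ hN.transcendental_past_shift.2 hy)
  rw [future_shift hN.one_lt, future_shift hN.one_lt] at hfuture
  rw [past_shift hN.one_lt hN.abs_conj, past_shift hN.one_lt hN.abs_conj] at hpast
  obtain ⟨s, hs, hnorm⟩ := hN.norm_unit
  have hs' : (s : ℝ) * s = 1 := by exact_mod_cast hs
  have hadd := hN.add_eq
  refine hN.eq_of_inDomain (p := s * r * (e'.1 1 - e.1 1)) (q := -s * (e'.1 1 - e.1 1)) hy
    (hN.inDomain_of_isAdmissible he hx hy) (hN.inDomain_of_isAdmissible he' hx' hy')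
    (mul_left_cancel₀ hN.lam_pos.ne' ?_) (mul_left_cancel₀ hN.mu_ne_zero ?_) <;> push_cast
  · linear_combination -hfuture + s * lam * ((e'.1 1 : ℝ) - e.1 1) * hadd -
      s * ((e'.1 1 : ℝ) - e.1 1) * hnorm - ((e'.1 1 : ℝ) - e.1 1) * hs'
  · linear_combination -hpast - s * mu * ((e'.1 1 : ℝ) - e.1 1) * hadd +
      s * ((e'.1 1 : ℝ) - e.1 1) * hnorm + ((e'.1 1 : ℝ) - e.1 1) * hs'

theorem value_translate_eq (hN : Numeration lam mu r c d D) {e e' : ℤ → ℕ}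
    (he : IsAdmissible d e) (he' : IsAdmissible d e')
    (hx : Transcendental ℚ (future lam e)) (hy : Transcendental ℚ (past mu e))
    (hfuture : future lam e = future lam e') (hpast : past mu e = past mu e') (m : ℤ) :
    (Transcendental ℚ (future lam (translate hN.one_lt e he.le m).1) ∧
      Transcendental ℚ (past mu (translate hN.one_lt e he.le m).1)) ∧
    future lam (translate hN.one_lt e he.le m).1 = future lam (translate hN.one_lt e' he'.le m).1 ∧
      past mu (translate hN.one_lt e he.le m).1 = past mu (translate hN.one_lt e' he'.le m).1 := by
  induction m with
  | zero => simpa [translate, ofBounded] using ⟨⟨hx, hy⟩, hfuture, hpast⟩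
  | succ m ih =>
    obtain ⟨⟨hxm, hym⟩, hfuture, hpast⟩ := ih
    rw [← shift_translate, ← shift_translate]
    exact ⟨⟨hN.transcendental_future_shift.2 hxm, hN.transcendental_past_shift.2 hym⟩,
      hN.value_shift_eq (he.comp_add m) (he'.comp_add m) hxm hym hfuture hpast⟩
  | pred m ih =>
    rw [← sub_add_cancel (-(m : ℤ)) 1, ← shift_translate, ← shift_translate,
      hN.transcendental_future_shift, hN.transcendental_past_shift] at ih
    obtain ⟨⟨hxm, hym⟩, hfuture, hpast⟩ := ih
    exact ⟨⟨hxm, hym⟩, hN.value_eq_of_value_shift_eq (he.comp_add _) (he'.comp_add _) hxm hym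
      hfuture hpast⟩

theorem eq_of_value_eq (hN : Numeration lam mu r c d D) {e e' : PrimarySeq lam}
    (he : IsAdmissible d e.1) (he' : IsAdmissible d e'.1)
    (hx : Transcendental ℚ (future lam e.1)) (hy : Transcendental ℚ (past mu e.1))
    (hfuture : future lam e.1 = future lam e'.1) (hpast : past mu e.1 = past mu e'.1) :
    e = e' := by
  have hvalue := hN.value_translate_eq he he' hx hy hfuture hpast
  apply Subtype.ext
  ext n
  have hnext := (hvalue (n - 1 + 1)).2.1
  rw [← shift_translate, ← shift_translate, future_shift hN.one_lt, future_shift hN.one_lt,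
    (hvalue (n - 1)).2.1, sub_right_inj] at hnext
  simpa [translate, ofBounded] using hnext

/-- A two-sided orbit `(X n, Y n)` of the natural extension, with the digits `e`. -/
structure IsOrbit (lam mu : ℝ) (r c : ℕ) (X Y : ℤ → ℝ) (e : ℤ → ℕ) : Prop where
  inDomain : ∀ n, InDomain lam r c (X n) (Y n)
  future_add_one : ∀ n, X (n + 1) = lam * X n - e (n + 1)
  past_add_one : ∀ n, Y (n + 1) = mu * Y n + e (n + 1)

theorem exists_inDomain_step (hN : Numeration lam mu r c d D) {x y : ℝ}
    (hx : Transcendental ℚ x) (h : InDomain lam r c x y) :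
    ∃ k : ℕ, InDomain lam r c (lam * x - k) (mu * y + k) := by
  have hlam0 := hN.lam_pos
  have hx0 := h.1.1
  have hxt : Transcendental ℚ (lam * x) := transcendental_of_eq_mul_add hx
    hN.isAlgebraic_lam.inv isAlgebraic_zero (by field_simp; ring)
  have hfloor : ((⌊lam * x⌋₊ : ℤ) : ℝ) < lam * x :=
    lt_of_le_of_ne (by exact_mod_cast Nat.floor_le (by positivity))
      (ne_of_transcendental hxt (isAlgebraic_intCast _)).symm
  exact ⟨⌊lam * x⌋₊, by
    exact_mod_cast hN.step x y _ h hfloor (by exact_mod_cast Nat.lt_floor_add_one _)⟩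

theorem exists_isOrbit (hN : Numeration lam mu r c d D) {x y : ℝ} (hx : Transcendental ℚ x)
    (hy : Transcendental ℚ y) (hxy : InDomain lam r c x y) :
    ∃ X Y : ℤ → ℝ, ∃ e : ℤ → ℕ, IsOrbit lam mu r c X Y e ∧ X 0 = x ∧ Y 0 = y := by
  have hxpow := transcendental_zpow_mul hx hN.isAlgebraic_lam hN.lam_pos.ne'
  have hypow := transcendental_zpow_mul hy hN.isAlgebraic_mu hN.mu_ne_zero
  choose p q hdomain using fun n => hN.exists_inDomain (hxpow n) (hypow n)
  have hYt (n : ℤ) := hN.transcendental_sub (hypow n) (p n) (q n)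
  choose k hk using fun n =>
    hN.exists_inDomain_step (hN.transcendental_add (hxpow n) (p n) (q n)) (hdomain n)
  obtain ⟨s, -, hnorm⟩ := hN.norm_unit
  have hadd := hN.add_eq
  have hstep (n : ℤ) := hN.eq_of_inDomain (hYt (n + 1)) (hdomain (n + 1)) (hk n)
    (p := -(q n) * s - k n - p (n + 1)) (q := p n + q n * r - q (n + 1))
    (by
      rw [zpow_add_one₀ hN.lam_pos.ne']
      push_cast
      linear_combination q n * lam * hadd - q n * hnorm)
    (by
      rw [zpow_add_one₀ hN.mu_ne_zero]
      push_cast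
      linear_combination -(q n * mu) * hadd + q n * hnorm)
  have hzero := hN.eq_of_inDomain hy hxy (hdomain 0) (p := p 0) (q := q 0) (by simp) (by simp)
  refine ⟨_, _, fun n => k (n - 1), ⟨hdomain, fun n => ?_, fun n => ?_⟩,
    hzero.1.symm, hzero.2.symm⟩
  · simpa using (hstep n).1
  · simpa using (hstep n).2

namespace IsOrbit

variable {X Y : ℤ → ℝ} {e : ℤ → ℕ}

theorem digit_le (h : IsOrbit lam mu r c X Y e) (hN : Numeration lam mu r c d D) (n : ℤ) :
    e n ≤ c := by
  have hnext := h.future_add_one (n - 1)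
  have hpos := (h.inDomain (n - 1 + 1)).1.1
  have hlt := (h.inDomain (n - 1)).1.2
  have hlam0 := hN.lam_pos
  have hdigit := hN.lt_digit
  rw [sub_add_cancel] at hnext hpos
  have : (e n : ℝ) < c + 1 := by nlinarith
  exact Nat.lt_succ_iff.1 (by exact_mod_cast this)

theorem isAdmissible (h : IsOrbit lam mu r c X Y e) (hN : Numeration lam mu r c d D) :
    IsAdmissible d e := by
  rintro N ⟨i, hpre, hlt⟩
  have hstep (j : ℕ) : X (N - 1 + (j + 1 : ℕ)) = lam * X (N - 1 + j) - e (N + j) := by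
    have := h.future_add_one (N - 1 + j)
    push_cast
    rwa [← add_assoc, show N + (j : ℤ) = N - 1 + j + 1 by ring]
  have hlam0 := hN.lam_pos
  have hvalue : ∀ j ≤ i, X (N - 1 + j) < D j := by
    intro j hj
    induction j with
    | zero => rw [hN.value_zero]; exact (h.inDomain _).1.2
    | succ j ih =>
      rw [hstep, hN.value_succ, hpre j (by omega)]
      have := ih (by omega)
      gcongr
  have hpos := (h.inDomain (N - 1 + (i + 1 : ℕ))).1.1
  rw [hstep] at hpos
  have hdigit : (d i : ℝ) + 1 ≤ e (N + i) := by exact_mod_cast hlt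
  have hmul : lam * X (N - 1 + i) < lam * D i := by
    have := hvalue i le_rfl
    gcongr
  linarith [hN.value_succ i, hN.value_le (i + 1)]

theorem future_eq (h : IsOrbit lam mu r c X Y e) (hN : Numeration lam mu r c d D) :
    future lam (translate hN.one_lt e (h.digit_le hN) 0).1 = X 0 := by
  let S := translate hN.one_lt e (h.digit_le hN)
  have hbound (n : ℤ) : |future lam (S n).1| ≤ ∑' k : ℤ, (c : ℝ) / lam ^ k.natAbs :=
    (isDominated_futureWeight hN.lam_pos).abs_weightedSum_le hN.one_lt fun _ => h.digit_le hN _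
  have hstep (n : ℤ) : future lam (S (n + 1)).1 = lam * future lam (S n).1 - e (n + 1) := by
    rw [show S (n + 1) = shift (S n) from (shift_translate ..).symm, future_shift hN.one_lt,
      add_comm n]
    rfl
  refine sub_eq_zero.1 (eq_zero_of_bounded_of_expanding hN.one_lt
    (f := fun n : ℕ => future lam (S n).1 - X n) (B := ∑' k : ℤ, (c : ℝ) / lam ^ k.natAbs + 1)
    (fun n => ?_) fun n => (abs_sub _ _).trans (add_le_add (hbound n) ?_))
  · rw [Nat.cast_succ, hstep, h.future_add_one, sub_sub_sub_cancel_right, ← mul_sub, norm_mul,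
      Real.norm_of_nonneg hN.lam_pos.le]
  · obtain ⟨hpos, hlt⟩ := (h.inDomain n).1
    exact abs_le.2 ⟨by linarith, hlt.le⟩

theorem past_eq (h : IsOrbit lam mu r c X Y e) (hN : Numeration lam mu r c d D) :
    past mu (translate hN.one_lt e (h.digit_le hN) 0).1 = Y 0 := by
  let S := translate hN.one_lt e (h.digit_le hN)
  have hbound (n : ℤ) : |past mu (S n).1| ≤ ∑' k : ℤ, (c : ℝ) / lam ^ k.natAbs :=
    (isDominated_pastWeight hN.abs_conj).abs_weightedSum_le hN.one_lt fun _ => h.digit_le hN _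
  have hstep (n : ℤ) : past mu (S (n + 1)).1 = mu * past mu (S n).1 + e (n + 1) := by
    rw [show S (n + 1) = shift (S n) from (shift_translate ..).symm,
      past_shift hN.one_lt hN.abs_conj, add_comm n]
    rfl
  have hzero := eq_zero_of_bounded_of_expanding hN.one_lt
    (f := fun n : ℕ => past mu (S (-n)).1 - Y (-n)) (B := ∑' k : ℤ, (c : ℝ) / lam ^ k.natAbs +
      max |(r : ℝ) - 1 - c| |lam|) (fun n => ?_) fun n =>
    (abs_sub _ _).trans (add_le_add (hbound _) ?_)
  · simpa [sub_eq_zero] using hzero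
  · have hpred : -(n : ℤ) = -((n + 1 : ℕ) : ℤ) + 1 := by push_cast; ring
    rw [hpred, hstep, h.past_add_one, add_sub_add_right_eq_sub, ← mul_sub, norm_mul,
      Real.norm_eq_abs mu, hN.abs_conj, mul_inv_cancel_left₀ hN.lam_pos.ne']
  · obtain ⟨hlow, hup⟩ := (h.inDomain (-n)).2.1
    exact abs_le_max_abs_abs hlow.le hup.le

end IsOrbit

theorem exists_code (hN : Numeration lam mu r c d D) {x y : ℝ} (hx : Transcendental ℚ x)
    (hy : Transcendental ℚ y) (hxy : InDomain lam r c x y) :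
    ∃ e : PrimarySeq lam, IsAdmissible d e.1 ∧ future lam e.1 = x ∧ past mu e.1 = y := by
  obtain ⟨X, Y, e, horbit, rfl, rfl⟩ := hN.exists_isOrbit hx hy hxy
  exact ⟨translate hN.one_lt e (horbit.digit_le hN) 0, (horbit.isAdmissible hN).comp_add 0,
    horbit.future_eq hN, horbit.past_eq hN⟩

theorem existsUnique_code (hN : Numeration lam mu r c d D) {x y : ℝ} (hx : Transcendental ℚ x)
    (hy : Transcendental ℚ y) :
    ∃! e : PrimarySeq lam, IsAdmissible d e.1 ∧
      ∃ p q : ℤ, future lam e.1 = x + (p + q * lam) ∧ past mu e.1 = y - (p + q * mu) := by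
  obtain ⟨p, q, hpq⟩ := hN.exists_inDomain hx hy
  obtain ⟨e, he, hfuture, hpast⟩ := hN.exists_code (hN.transcendental_add hx p q)
    (hN.transcendental_sub hy p q) hpq
  refine ⟨e, ⟨he, p, q, hfuture, hpast⟩, ?_⟩
  rintro e' ⟨he', p', q', hfuture', hpast'⟩
  have hx' : Transcendental ℚ (future lam e'.1) := hfuture' ▸ hN.transcendental_add hx _ _
  have hy' : Transcendental ℚ (past mu e'.1) := hpast' ▸ hN.transcendental_sub hy _ _
  obtain ⟨hfutureEq, hpastEq⟩ := hN.eq_of_inDomain hy' (hN.inDomain_of_isAdmissible he' hx' hy')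
    hpq (p := p - p') (q := q - q') (by rw [hfuture']; push_cast; ring)
    (by rw [hpast']; push_cast; ring)
  exact hN.eq_of_value_eq he' he hx' hy' (hfutureEq.trans hfuture.symm)
    (hpastEq.trans hpast.symm)

end Numeration

/-! ### The torus and the homoclinic points -/

section Torus

variable {M : Matrix (Fin 2) (Fin 2) ℤ}

/-- The inclusion of the integral lattice in the plane. -/
def intVec : (Fin 2 → ℤ) →+ (Fin 2 → ℝ) := (Int.castAddHom ℝ).compLeft (Fin 2)

theorem intVec_apply (k : Fin 2 → ℤ) (i : Fin 2) : intVec k i = k i := rfl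

theorem intVec_injective : Function.Injective intVec := fun _ _ h =>
  funext fun i => Int.cast_injective (congr_fun h i)

/-- The projection of the plane onto the torus. -/
def proj : (Fin 2 → ℝ) →+ UnitAddTorus (Fin 2) :=
  (QuotientAddGroup.mk' (AddSubgroup.zmultiples (1 : ℝ))).compLeft (Fin 2)

theorem proj_apply (y : Fin 2 → ℝ) (i : Fin 2) : proj y i = (y i : UnitAddCircle) := rfl

theorem continuous_proj : Continuous proj :=
  continuous_pi fun i => (AddCircle.continuous_mk' (1 : ℝ)).comp (continuous_apply i)

theorem proj_surjective : Function.Surjective proj := by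
  intro z
  choose y hy using fun i => QuotientAddGroup.mk_surjective (z i)
  exact ⟨y, funext hy⟩

theorem proj_eq_zero_iff {y : Fin 2 → ℝ} : proj y = 0 ↔ ∃ k, y = intVec k := by
  simp only [funext_iff, ← Classical.skolem (p := fun (i : Fin 2) (k : ℤ) => y i = k),
    intVec_apply]
  refine forall_congr' fun i => ?_
  rw [proj_apply, Pi.zero_apply, AddCircle.coe_eq_zero_iff]
  simp [eq_comm]

theorem proj_eq_iff {y y' : Fin 2 → ℝ} : proj y = proj y' ↔ ∃ k, y = y' + intVec k := by
  rw [← sub_eq_zero, ← map_sub, proj_eq_zero_iff]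
  simp only [sub_eq_iff_eq_add']

theorem ae_of_ae_proj {p : UnitAddTorus (Fin 2) → Prop} (h : ∀ᵐ y : Fin 2 → ℝ, p (proj y)) :
    ∀ᵐ z : UnitAddTorus (Fin 2), p z := by
  have hcoord : MeasureTheory.MeasurePreserving
      (fun x : UnitAddCircle => (AddCircle.equivIoc (1 : ℝ) 0 x : ℝ)) MeasureTheory.volume
      (MeasureTheory.volume.restrict (Set.Ioc 0 (0 + 1))) :=
    .comp ⟨measurable_subtype_coe, map_comap_subtype_coe measurableSet_Ioc _⟩
      (AddCircle.measurePreserving_equivIoc 1)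
  have hlift := MeasureTheory.measurePreserving_pi (ι := Fin 2) _ _ fun _ => hcoord
  rw [← MeasureTheory.Measure.restrict_pi_pi (fun _ : Fin 2 => MeasureTheory.volume)
    (fun _ => Set.Ioc (0 : ℝ) (0 + 1))] at hlift
  have hquasi := hlift.quasiMeasurePreserving.mono_right
    MeasureTheory.Measure.restrict_le_self.absolutelyContinuous
  filter_upwards [hquasi.ae h] with z hz
  convert hz
  ext i
  exact ((AddCircle.equivIoc (1 : ℝ) 0).symm_apply_apply (z i)).symm

theorem ae_apply_notMem_of_volume_eq_zero {ℓ : (Fin 2 → ℝ) →ₗ[ℝ] ℝ} (hℓ : Function.Surjective ℓ)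
    {F : Set ℝ} (hF : MeasureTheory.volume F = 0) : ∀ᵐ y : Fin 2 → ℝ, ℓ y ∉ F := by
  obtain ⟨c, -, -, hc⟩ := ℓ.exists_map_addHaar_eq_smul_addHaar' MeasureTheory.volume
    MeasureTheory.volume hℓ
  refine MeasureTheory.ae_of_ae_map ℓ.continuous_of_finiteDimensional.measurable.aemeasurable
    (MeasureTheory.measure_eq_zero_iff_ae_notMem.1 ?_)
  rw [hc, MeasureTheory.Measure.smul_apply, hF, smul_zero]

theorem toralMap_injective (hdet : IsUnit M.det) : Function.Injective (toralMap M) := by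
  have hadj (z : UnitAddTorus (Fin 2)) :
      M 1 1 • toralMap M z 0 - M 0 1 • toralMap M z 1 = M.det • z 0 ∧
        M 0 0 • toralMap M z 1 - M 1 0 • toralMap M z 0 = M.det • z 1 := by
    simp only [toralMap, Fin.sum_univ_two, Matrix.det_fin_two]
    constructor <;> module
  intro z z' h
  ext i
  refine hdet.smul_left_cancel.1 ?_
  fin_cases i
  · rw [Fin.zero_eta, ← (hadj z).1, ← (hadj z').1, h]
  · rw [Fin.mk_one, ← (hadj z).2, ← (hadj z').2, h]

/-- The linear map of the plane given by an integral matrix. -/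
def realMap (M : Matrix (Fin 2) (Fin 2) ℤ) : (Fin 2 → ℝ) →ₗ[ℝ] (Fin 2 → ℝ) :=
  Matrix.toLin' (M.map (Int.cast : ℤ → ℝ))

theorem realMap_apply (x : Fin 2 → ℝ) (i : Fin 2) : realMap M x i = ∑ j, (M i j : ℝ) * x j := rfl

theorem realMap_intVec (k : Fin 2 → ℤ) : realMap M (intVec k) = intVec (M.mulVec k) := by
  ext i
  simp only [realMap_apply, intVec_apply, Matrix.mulVec, dotProduct, Int.cast_sum, Int.cast_mul]

theorem eq_zero_of_realMap_intVec_eq_smul {k : Fin 2 → ℤ} {a : ℝ} (ha : Irrational a)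
    (h : realMap M (intVec k) = a • intVec k) : k = 0 := by
  rw [realMap_intVec] at h
  ext i
  have hi : (M.mulVec k i : ℝ) = a * k i := congr_fun h i
  exact neg_eq_zero.1 (eq_zero_of_intCast_add_mul_eq_zero ha
    (p := M.mulVec k i) (q := -k i) (by push_cast; linarith)).2

theorem realMap_realMap (x : Fin 2 → ℝ) :
    realMap M (realMap M x) = (M.trace : ℝ) • realMap M x - (M.det : ℝ) • x := by
  ext i
  rw [Matrix.trace_fin_two, Matrix.det_fin_two]
  fin_cases i <;>
    simp only [realMap_apply, Fin.sum_univ_two, Pi.sub_apply, Pi.smul_apply, smul_eq_mul,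
      Fin.zero_eta, Fin.mk_one] <;> push_cast <;> ring

theorem toralMap_proj (y : Fin 2 → ℝ) : toralMap M (proj y) = proj (realMap M y) := by
  ext i
  simp only [toralMap, proj_apply, realMap_apply, Fin.sum_univ_two, AddCircle.coe_add]
  congr 1 <;> rw [← AddCircle.coe_zsmul, zsmul_eq_mul]

end Torus

/-- The vector `(n, k) = -det M • M (-v, u)`, which turns out to be the sum of the homoclinic point
with the parameters `(u, v)` and its conjugate. -/
def latticeVec (M : Matrix (Fin 2) (Fin 2) ℤ) (u v : ℤ) : Fin 2 → ℤ :=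
  -M.det • M.mulVec ![-v, u]

/-- The conjugate of `homoclinicPoint M u v` over `ℚ`. -/
def conjPoint (M : Matrix (Fin 2) (Fin 2) ℤ) (u v : ℤ) : Fin 2 → ℝ :=
  intVec (latticeVec M u v) - homoclinicPoint M u v

/-- The linear map `(x, y) ↦ x t - y t'`, where `t` is a homoclinic point and `t'` its conjugate. -/
def planeMap (M : Matrix (Fin 2) (Fin 2) ℤ) (u v : ℤ) : (Fin 2 → ℝ) →ₗ[ℝ] (Fin 2 → ℝ) :=
  (LinearMap.proj 0).smulRight (homoclinicPoint M u v) -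
    (LinearMap.proj 1).smulRight (conjPoint M u v)

/-- The matrix with the columns `g` and `M g`, where `g = latticeVec M u v`. -/
def latticeMatrix (M : Matrix (Fin 2) (Fin 2) ℤ) (u v : ℤ) : Matrix (Fin 2) (Fin 2) ℤ :=
  !![latticeVec M u v 0, M.mulVec (latticeVec M u v) 0;
    latticeVec M u v 1, M.mulVec (latticeVec M u v) 1]

section HomoclinicPoint

variable (M : Matrix (Fin 2) (Fin 2) ℤ) (u v : ℤ)

theorem planeMap_apply (x : Fin 2 → ℝ) :
    planeMap M u v x = x 0 • homoclinicPoint M u v - x 1 • conjPoint M u v := rfl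

theorem homoclinicPoint_add_conjPoint :
    homoclinicPoint M u v + conjPoint M u v = intVec (latticeVec M u v) :=
  add_sub_cancel _ _

theorem homoclinicPoint_sub (u' v' : ℤ) :
    homoclinicPoint M (u - u') (v - v') = homoclinicPoint M u v - homoclinicPoint M u' v' := by
  ext i
  fin_cases i <;>
    simp only [homoclinicPoint, Fin.zero_eta, Fin.mk_one, Matrix.mulVec_fin_two,
      Matrix.cons_val_zero, Matrix.cons_val_one, Matrix.cons_val_fin_one, Pi.smul_apply,
      Pi.sub_apply, smul_eq_mul] <;>
    push_cast <;> ring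

theorem intVec_latticeMatrix_mulVec (a : Fin 2 → ℤ) :
    intVec ((latticeMatrix M u v).mulVec a) = (a 0 : ℝ) • intVec (latticeVec M u v) +
      (a 1 : ℝ) • realMap M (intVec (latticeVec M u v)) := by
  rw [realMap_intVec]
  ext i
  fin_cases i <;>
    simp only [latticeMatrix, intVec_apply, Fin.zero_eta, Fin.mk_one, Matrix.mulVec_fin_two,
      Matrix.cons_val_zero, Matrix.cons_val_one, Matrix.cons_val_fin_one, Matrix.of_apply,
      Matrix.cons_val', Pi.add_apply, Pi.smul_apply, smul_eq_mul] <;>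
    push_cast <;> ring

theorem det_latticeMatrix :
    (latticeMatrix M u v).det = -(M.det ^ 3 * assocForm M u v) := by
  rw [latticeMatrix, Matrix.det_fin_two, assocForm, latticeVec, Matrix.det_fin_two]
  simp only [Matrix.mulVec_fin_two, Matrix.cons_val_zero, Matrix.cons_val_one,
    Matrix.cons_val_fin_one, Matrix.of_apply, Matrix.cons_val', Pi.smul_apply, smul_eq_mul]
  ring

end HomoclinicPoint

theorem natCard_quotient_range_toLin' {n : Type*} [Fintype n] [DecidableEq n] {A : Matrix n n ℤ}
    (hA : A.det ≠ 0) : Nat.card ((n → ℤ) ⧸ LinearMap.range A.toLin') = A.det.natAbs := by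
  have hinj : Function.Injective A.toLin' :=
    (injective_iff_map_eq_zero _).2 fun a ha => Matrix.eq_zero_of_mulVec_eq_zero hA ha
  rw [← Submodule.natAbs_det_equiv _ (LinearEquiv.ofInjective _ hinj), ← LinearMap.det_toLin']
  rfl

namespace IsHyperbolicUnit

variable {M : Matrix (Fin 2) (Fin 2) ℤ} {u v : ℤ}

theorem exists_numeration (hM : IsHyperbolicUnit M) :
    ∃ r c d D, Numeration (eigen M) (conjEigen M) r c d D := by
  rcases Int.isUnit_iff.1 hM.isUnit_det with hdet | hdet
  · obtain ⟨s, hs⟩ := Int.eq_ofNat_of_zero_le (a := M.trace - 2)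
      (by linarith [hM.three_le_trace hdet])
    refine ⟨_, _, _, _, numeration_one (s := s) hM.one_lt_eigen
      (by rw [hM.eigen_mul_conjEigen, hdet, Int.cast_one]) ?_⟩
    rw [eigen_add_conjEigen, ← Int.cast_natCast, ← hs]
    push_cast
    ring
  · obtain ⟨r, hr⟩ := Int.eq_ofNat_of_zero_le hM.trace_pos.le
    refine ⟨_, _, _, _, numeration_negOne (r := r) hM.one_lt_eigen
      (by rw [hM.eigen_mul_conjEigen, hdet, Int.cast_neg, Int.cast_one]) ?_⟩
    rw [eigen_add_conjEigen, hr, Int.cast_natCast]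

theorem conjEigen_ne_zero (hM : IsHyperbolicUnit M) : conjEigen M ≠ 0 :=
  abs_pos.1 (hM.abs_conjEigen ▸ inv_pos.2 hM.eigen_pos)

theorem eigen_sub_conjEigen_ne_zero (hM : IsHyperbolicUnit M) : eigen M - conjEigen M ≠ 0 :=
  sqrt_disc_eq M ▸ hM.sqrt_disc_pos.ne'

theorem mulVec_latticeVec (hM : IsHyperbolicUnit M) (u v : ℤ) :
    M.mulVec (latticeVec M u v) = ![-v, u] + M.trace • latticeVec M u v := by
  have hsq := hM.det_mul_det
  rw [Matrix.det_fin_two] at hsq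
  ext i
  rw [latticeVec, Matrix.trace_fin_two, Matrix.det_fin_two]
  fin_cases i <;>
    simp only [Fin.zero_eta, Fin.mk_one, Matrix.mulVec_fin_two, Matrix.cons_val_zero,
      Matrix.cons_val_one, Matrix.cons_val_fin_one, Pi.smul_apply, Pi.add_apply, smul_eq_mul]
  · linear_combination -v * hsq
  · linear_combination u * hsq

theorem latticeVec_ne_zero (hM : IsHyperbolicUnit M) (h : (u, v) ≠ (0, 0)) :
    latticeVec M u v ≠ 0 := by
  intro hzero
  have hvec := hM.mulVec_latticeVec u v
  rw [hzero, Matrix.mulVec_zero, smul_zero, add_zero] at hvec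
  refine h (Prod.ext ?_ ?_)
  · simpa using (congr_fun hvec 1).symm
  · simpa using (congr_fun hvec 0).symm

theorem exists_latticeVec_eq (hM : IsHyperbolicUnit M) (k : Fin 2 → ℤ) :
    ∃ u v, latticeVec M u v = k := by
  refine ⟨M 1 0 * k 0 - M 0 0 * k 1, M 1 1 * k 0 - M 0 1 * k 1, ?_⟩
  have hsq := hM.det_mul_det
  rw [Matrix.det_fin_two] at hsq
  ext i
  rw [latticeVec, Matrix.det_fin_two]
  fin_cases i <;>
    simp only [Fin.zero_eta, Fin.mk_one, Matrix.mulVec_fin_two, Matrix.cons_val_zero,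
      Matrix.cons_val_one, Matrix.cons_val_fin_one, Pi.smul_apply, smul_eq_mul]
  · linear_combination k 0 * hsq
  · linear_combination k 1 * hsq

theorem sub_smul_homoclinicPoint (hM : IsHyperbolicUnit M) (u v : ℤ) :
    (eigen M - conjEigen M) • homoclinicPoint M u v =
      realMap M (intVec (latticeVec M u v)) - conjEigen M • intVec (latticeVec M u v) := by
  rw [realMap_intVec, hM.mulVec_latticeVec]
  ext i
  have htrace := eigen_add_conjEigen M
  simp only [Pi.smul_apply, Pi.sub_apply, homoclinicPoint, ← sqrt_disc_eq, smul_eq_mul,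
    mul_div_cancel₀ _ hM.sqrt_disc_pos.ne', intVec_apply, Pi.add_apply, Int.cast_add,
    Int.cast_mul, ← htrace, latticeVec]
  ring

theorem realMap_homoclinicPoint (hM : IsHyperbolicUnit M) (u v : ℤ) :
    realMap M (homoclinicPoint M u v) = eigen M • homoclinicPoint M u v := by
  apply smul_right_injective _ hM.eigen_sub_conjEigen_ne_zero
  simp only [← map_smul, smul_comm _ (eigen M), hM.sub_smul_homoclinicPoint]
  rw [map_sub, map_smul, realMap_realMap, ← hM.eigen_mul_conjEigen, ← eigen_add_conjEigen]
  module

theorem realMap_conjPoint (hM : IsHyperbolicUnit M) (u v : ℤ) :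
    realMap M (conjPoint M u v) = conjEigen M • conjPoint M u v := by
  have hmap := sub_eq_iff_eq_add.1 (hM.sub_smul_homoclinicPoint u v).symm
  rw [conjPoint, map_sub, hM.realMap_homoclinicPoint, hmap]
  module

theorem realMap_planeMap (hM : IsHyperbolicUnit M) (u v : ℤ) (x : Fin 2 → ℝ) :
    realMap M (planeMap M u v x) = planeMap M u v ![eigen M * x 0, conjEigen M * x 1] := by
  simp only [planeMap_apply, map_sub, map_smul, hM.realMap_homoclinicPoint,
    hM.realMap_conjPoint, Matrix.cons_val_zero, Matrix.cons_val_one]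
  module

theorem planeMap_lattice (hM : IsHyperbolicUnit M) (u v : ℤ) (a : Fin 2 → ℤ) :
    planeMap M u v ![a 0 + a 1 * eigen M, -(a 0 + a 1 * conjEigen M)] =
      intVec ((latticeMatrix M u v).mulVec a) := by
  rw [intVec_latticeMatrix_mulVec, ← homoclinicPoint_add_conjPoint, map_add,
    hM.realMap_homoclinicPoint, hM.realMap_conjPoint, planeMap_apply]
  simp only [Matrix.cons_val_zero, Matrix.cons_val_one]
  module


theorem homoclinicPoint_ne_zero (hM : IsHyperbolicUnit M) (h : (u, v) ≠ (0, 0)) :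
    homoclinicPoint M u v ≠ 0 := by
  intro hzero
  have hvec := hM.sub_smul_homoclinicPoint u v
  rw [hzero, smul_zero, eq_comm, sub_eq_zero] at hvec
  exact hM.latticeVec_ne_zero h (eq_zero_of_realMap_intVec_eq_smul hM.irrational_conjEigen hvec)

theorem conjPoint_ne_zero (hM : IsHyperbolicUnit M) (h : (u, v) ≠ (0, 0)) :
    conjPoint M u v ≠ 0 := by
  intro hzero
  have hvec := hM.realMap_homoclinicPoint u v
  rw [← sub_eq_zero.1 hzero] at hvec
  exact hM.latticeVec_ne_zero h (eq_zero_of_realMap_intVec_eq_smul hM.irrational_eigen hvec)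

theorem eq_zero_of_proj_smul_homoclinicPoint (hM : IsHyperbolicUnit M) (h : (u, v) ≠ (0, 0))
    {s : ℝ} (hs : proj (s • homoclinicPoint M u v) = 0) : s = 0 := by
  obtain ⟨k, hk⟩ := proj_eq_zero_iff.1 hs
  have hzero : k = 0 := eq_zero_of_realMap_intVec_eq_smul hM.irrational_eigen
    (by rw [← hk, map_smul, hM.realMap_homoclinicPoint, smul_comm])
  rw [hzero, map_zero] at hk
  exact (smul_eq_zero.1 hk).resolve_right (hM.homoclinicPoint_ne_zero h)

theorem planeMap_injective (hM : IsHyperbolicUnit M) (h : (u, v) ≠ (0, 0)) :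
    Function.Injective (planeMap M u v) := by
  refine (injective_iff_map_eq_zero _).2 fun x hx => ?_
  have hx' := hM.realMap_planeMap u v x
  rw [hx, map_zero] at hx'
  simp only [planeMap_apply, Matrix.cons_val_zero, Matrix.cons_val_one] at hx hx'
  have hfst : ((eigen M - conjEigen M) * x 0) • homoclinicPoint M u v = 0 := by
    linear_combination (norm := module) -hx' - conjEigen M • hx
  have hsnd : ((eigen M - conjEigen M) * x 1) • conjPoint M u v = 0 := by
    linear_combination (norm := module) -hx' - eigen M • hx
  have hdiff := hM.eigen_sub_conjEigen_ne_zero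
  ext i
  fin_cases i
  · simpa [hdiff, hM.homoclinicPoint_ne_zero h] using hfst
  · simpa [hdiff, hM.conjPoint_ne_zero h] using hsnd

theorem planeMap_surjective (hM : IsHyperbolicUnit M) (h : (u, v) ≠ (0, 0)) :
    Function.Surjective (planeMap M u v) :=
  LinearMap.injective_iff_surjective.1 (hM.planeMap_injective h)

theorem ae_planeMap_coord_notMem (hM : IsHyperbolicUnit M) (h : (u, v) ≠ (0, 0)) (i : Fin 2)
    {F : Set ℝ} (hF : MeasureTheory.volume F = 0) :
    ∀ᵐ z : UnitAddTorus (Fin 2), ∀ x : Fin 2 → ℝ, proj (planeMap M u v x) = z → x i ∉ F := by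
  let e := LinearEquiv.ofInjectiveEndo (planeMap M u v) (hM.planeMap_injective h)
  let ℓ : (Fin 2 → ℝ) →ₗ[ℝ] ℝ := (LinearMap.proj i).comp e.symm.toLinearMap
  have hℓ : Function.Surjective ℓ := (Function.surjective_eval i).comp e.symm.surjective
  have htranslate (k : Fin 2 → ℤ) :
      ∀ᵐ y : Fin 2 → ℝ, ℓ y ∉ (fun t => t + ℓ (intVec k)) ⁻¹' F :=
    ae_apply_notMem_of_volume_eq_zero hℓ
      (by rw [MeasureTheory.measure_preimage_add_right, hF])
  apply ae_of_ae_proj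
  filter_upwards [MeasureTheory.ae_all_iff.2 htranslate] with y hy x hx hxF
  obtain ⟨k, hk⟩ := proj_eq_iff.1 hx
  refine hy k ?_
  have hsymm : e.symm (planeMap M u v x) = x := e.symm_apply_apply x
  have hcoord : ℓ (planeMap M u v x) = x i := congr_fun hsymm i
  rwa [Set.mem_preimage, ← map_add, ← hk, hcoord]

theorem ae_transcendental (hM : IsHyperbolicUnit M) (h : (u, v) ≠ (0, 0)) :
    ∀ᵐ z : UnitAddTorus (Fin 2), ∀ x : Fin 2 → ℝ, proj (planeMap M u v x) = z →
      Transcendental ℚ (x 0) ∧ Transcendental ℚ (x 1) := by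
  have hnull : MeasureTheory.volume {x : ℝ | IsAlgebraic ℚ x} = 0 :=
    (Algebraic.countable ℚ ℝ).measure_zero _
  filter_upwards [hM.ae_planeMap_coord_notMem h 0 hnull, hM.ae_planeMap_coord_notMem h 1 hnull]
    with z hfst hsnd x hx
  exact ⟨hfst x hx, hsnd x hx⟩

theorem det_latticeMatrix_ne_zero (hM : IsHyperbolicUnit M) (h : (u, v) ≠ (0, 0)) :
    (latticeMatrix M u v).det ≠ 0 := by
  intro hdet
  obtain ⟨a, ha, hzero⟩ := Matrix.exists_mulVec_eq_zero_iff.2 hdet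
  have hplane := hM.planeMap_lattice u v a
  rw [hzero, map_zero] at hplane
  have hcoord := congr_fun ((map_eq_zero_iff _ (hM.planeMap_injective h)).1 hplane) 0
  obtain ⟨hfst, hsnd⟩ := eq_zero_of_intCast_add_mul_eq_zero hM.irrational_eigen hcoord
  exact ha (funext (Fin.forall_fin_two.2 ⟨hfst, hsnd⟩))

theorem natAbs_det_latticeMatrix (hM : IsHyperbolicUnit M) (u v : ℤ) :
    (latticeMatrix M u v).det.natAbs = (assocForm M u v).natAbs := by
  rw [det_latticeMatrix, Int.natAbs_neg, Int.natAbs_mul, Int.natAbs_pow,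
    Int.isUnit_iff_natAbs_eq.1 hM.isUnit_det, one_pow, one_mul]

theorem assocForm_ne_zero (hM : IsHyperbolicUnit M) (h : (u, v) ≠ (0, 0)) :
    assocForm M u v ≠ 0 :=
  Int.natAbs_ne_zero.1 (hM.natAbs_det_latticeMatrix u v ▸
    Int.natAbs_ne_zero.2 (hM.det_latticeMatrix_ne_zero h))

end IsHyperbolicUnit

/-! ### The codings associated with the homoclinic points -/

namespace Numeration

variable {lam mu : ℝ} {r c : ℕ} {d : ℕ → ℕ} {D : ℕ → ℝ} {e e' : PrimarySeq lam}

theorem future_sub_value (hN : Numeration lam mu r c d D) (e : PrimarySeq lam) {i : ℕ}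
    (h : ∀ k < i, e.1 (k + 1) = d k) :
    future lam (shift^[i] e).1 - D i = lam ^ i * (future lam e.1 - 1) := by
  induction i with
  | zero => simp [hN.value_zero]
  | succ i ih =>
    rw [future_shift_iterate_succ hN.one_lt, hN.value_succ, h i i.lt_succ_self, pow_succ']
    linear_combination lam * ih fun k hk => h k (hk.trans i.lt_succ_self)

theorem future_le_one (hN : Numeration lam mu r c d D) (he : IsAdmissible d e.1) :
    future lam e.1 ≤ 1 :=
  (hN.region e he).1

theorem apply_eq_of_future_eq_one (hN : Numeration lam mu r c d D) (he : IsAdmissible d e.1)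
    (hone : future lam e.1 = 1) (k : ℕ) : e.1 (k + 1) = d k := by
  induction k using Nat.strong_induction_on with
  | _ k ih =>
    have hvalue : future lam (shift^[k] e).1 = D k := by
      simpa [hone, sub_eq_zero] using hN.future_sub_value e ih
    refine le_antisymm (not_lt.1 fun hlt => he 1 ⟨k, fun j hj => ?_, ?_⟩) (Nat.lt_succ_iff.1 ?_)
    · rw [← ih j hj, add_comm]
    · simpa only [add_comm] using hlt
    · have hle := hN.future_le_one (isAdmissible_shift_iterate (k := k + 1).2 he)
      rw [future_shift_iterate_succ hN.one_lt, hvalue] at hle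
      have hpos := hN.value_pos (k + 1)
      rw [hN.value_succ] at hpos
      have : (d k : ℝ) < e.1 (k + 1) + 1 := by linarith
      exact_mod_cast this

theorem future_lt_one (hN : Numeration lam mu r c d D) (he : IsAdmissible d e.1)
    (hf : IsFinite e) : future lam e.1 < 1 := by
  refine (hN.future_le_one he).lt_of_ne fun hone => ?_
  obtain ⟨n, hn⟩ := hf.exists_bounds
  have hvalue := hN.future_sub_value e (i := n) fun k _ => hN.apply_eq_of_future_eq_one he hone k
  rw [hone, sub_self, mul_zero, sub_eq_zero, future_eq_zero] at hvalue
  · exact (hN.value_pos n).ne hvalue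
  · intro m hm
    rw [shift_iterate_apply]
    by_contra hne
    have := (hn _ hne).2
    omega

theorem apply_one_eq_of_future_eq (hN : Numeration lam mu r c d D) (he : IsAdmissible d e.1)
    (he' : IsAdmissible d e'.1) (hf : IsFinite e) (hf' : IsFinite e')
    (h : future lam e.1 = future lam e'.1) : e.1 1 = e'.1 1 := by
  have hmem {f : PrimarySeq lam} (hfa : IsAdmissible d f.1) (hff : IsFinite f) :
      0 ≤ lam * future lam f.1 - f.1 1 ∧ lam * future lam f.1 - f.1 1 < 1 := by
    rw [← future_shift hN.one_lt]
    exact ⟨future_nonneg hN.lam_pos _,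
      hN.future_lt_one (isAdmissible_shift.2 hfa) (isFinite_shift.2 hff)⟩
  have hfloor {f : PrimarySeq lam} (hfa : IsAdmissible d f.1) (hff : IsFinite f) :
      ⌊lam * future lam f.1⌋ = f.1 1 :=
    Int.floor_eq_iff.2 ⟨by simpa using (hmem hfa hff).1, by
      simpa using sub_lt_iff_lt_add'.1 (hmem hfa hff).2⟩
  exact_mod_cast (hfloor he hf).symm.trans (h ▸ hfloor he' hf')

theorem apply_eq_of_future_eq (hN : Numeration lam mu r c d D) (he : IsAdmissible d e.1)
    (he' : IsAdmissible d e'.1) (hf : IsFinite e) (hf' : IsFinite e')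
    (h : future lam e.1 = future lam e'.1) (n : ℕ) : e.1 (n + 1) = e'.1 (n + 1) := by
  have hfirst := hN.apply_one_eq_of_future_eq he he' hf hf' h
  induction n generalizing e e' with
  | zero => simpa using hfirst
  | succ n ih =>
    have hshift : future lam (shift e).1 = future lam (shift e').1 := by
      rw [future_shift hN.one_lt, future_shift hN.one_lt, h, hfirst]
    have := ih (isAdmissible_shift.2 he) (isAdmissible_shift.2 he') (isFinite_shift.2 hf)
      (isFinite_shift.2 hf') hshift (hN.apply_one_eq_of_future_eq (isAdmissible_shift.2 he)
        (isAdmissible_shift.2 he') (isFinite_shift.2 hf) (isFinite_shift.2 hf') hshift)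
    simpa [shift_apply] using this

end Numeration

/-- The regularized series `(∑_n ε_n λ ^ (-n)) t`, where `t` is the homoclinic point with the
parameters `(u, v)`: the terms with `n ≤ 0` are replaced by the negatives of their conjugates, from
which they differ by integral vectors. -/
def planeSum (M : Matrix (Fin 2) (Fin 2) ℤ) (u v : ℤ) (e : ℤ → ℕ) : Fin 2 → ℝ :=
  planeMap M u v ![future (eigen M) e, past (conjEigen M) e]

theorem planeSum_eq_of_forall_nonpos {M : Matrix (Fin 2) (Fin 2) ℤ} {u v : ℤ} {e : ℤ → ℕ}
    (h : ∀ n ≤ 0, e n = 0) : planeSum M u v e = future (eigen M) e • homoclinicPoint M u v := by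
  simp [planeSum, planeMap_apply, past_eq_zero h]

namespace IsHyperbolicUnit

variable {M : Matrix (Fin 2) (Fin 2) ℤ} {u v : ℤ} {r c : ℕ} {d : ℕ → ℕ} {D : ℕ → ℝ}

theorem planeSum_add (hM : IsHyperbolicUnit M) (u v : ℤ) (e e' : PrimarySeq (eigen M)) :
    planeSum M u v (e + e').1 = planeSum M u v e.1 + planeSum M u v e'.1 := by
  rw [planeSum, planeSum, planeSum, ← map_add, future_add hM.one_lt_eigen,
    past_add hM.abs_conjEigen, Matrix.cons_add_cons, Matrix.cons_add_cons, Matrix.empty_add_empty]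

theorem planeSum_shift (hM : IsHyperbolicUnit M) (u v : ℤ) (e : PrimarySeq (eigen M)) :
    planeSum M u v (shift e).1 =
      realMap M (planeSum M u v e.1) + intVec ((latticeMatrix M u v).mulVec ![-e.1 1, 0]) := by
  rw [planeSum, planeSum, hM.realMap_planeMap, ← hM.planeMap_lattice, ← map_add,
    future_shift hM.one_lt_eigen, past_shift hM.one_lt_eigen hM.abs_conjEigen]
  congr 1
  ext i
  fin_cases i <;> simp [sub_eq_add_neg]

/-- The homomorphism `ε ↦ (∑_n ε_n λ ^ (-n)) t mod ℤ²`, where `t` is the homoclinic point with the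
parameters `(u, v)`. -/
def phi (hM : IsHyperbolicUnit M) (u v : ℤ) : PrimarySeq (eigen M) →+ UnitAddTorus (Fin 2) where
  toFun e := proj (planeSum M u v e.1)
  map_zero' := by
    have hzero (n : ℤ) : (0 : PrimarySeq (eigen M)).1 n = 0 := rfl
    rw [planeSum_eq_of_forall_nonpos fun n _ => hzero n, future_eq_zero fun n _ => hzero n,
      zero_smul, map_zero]
  map_add' e e' := by rw [hM.planeSum_add, map_add]

theorem phi_apply (hM : IsHyperbolicUnit M) (u v : ℤ) (e : PrimarySeq (eigen M)) :
    hM.phi u v e = proj (planeSum M u v e.1) := rfl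

theorem phi_shift (hM : IsHyperbolicUnit M) (u v : ℤ) (e : PrimarySeq (eigen M)) :
    hM.phi u v (shift e) = toralMap M (hM.phi u v e) := by
  rw [phi_apply, phi_apply, toralMap_proj]
  exact proj_eq_iff.2 ⟨_, hM.planeSum_shift u v e⟩

theorem continuous_phi (hM : IsHyperbolicUnit M) (u v : ℤ) :
    Continuous[seqTopology (eigen M), inferInstance] (hM.phi u v) := by
  let _ := seqTopology (eigen M)
  refine continuous_proj.comp ((planeMap M u v).continuous_of_finiteDimensional.comp ?_)
  refine continuous_pi fun i => ?_
  fin_cases i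
  · exact (isDominated_futureWeight hM.eigen_pos).continuous
  · exact (isDominated_pastWeight hM.abs_conjEigen).continuous

theorem planeMap_eq_add_lattice_iff (hM : IsHyperbolicUnit M) (h : (u, v) ≠ (0, 0))
    {x x' : Fin 2 → ℝ} {a : Fin 2 → ℤ} :
    planeMap M u v x' = planeMap M u v x + intVec ((latticeMatrix M u v).mulVec a) ↔
      x' 0 = x 0 + (a 0 + a 1 * eigen M) ∧ x' 1 = x 1 - (a 0 + a 1 * conjEigen M) := by
  rw [← hM.planeMap_lattice, ← map_add, (hM.planeMap_injective h).eq_iff, funext_iff,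
    Fin.forall_fin_two]
  rfl

theorem existsUnique_planeSum_eq (hM : IsHyperbolicUnit M)
    (hN : Numeration (eigen M) (conjEigen M) r c d D) (h : (u, v) ≠ (0, 0)) {y : Fin 2 → ℝ}
    (hy : ∀ x, proj (planeMap M u v x) = proj y → Transcendental ℚ (x 0) ∧ Transcendental ℚ (x 1)) :
    ∃! e : PrimarySeq (eigen M), IsAdmissible d e.1 ∧
      ∃ a, planeSum M u v e.1 = y + intVec ((latticeMatrix M u v).mulVec a) := by
  obtain ⟨x, rfl⟩ := hM.planeMap_surjective h y
  convert hN.existsUnique_code (hy x rfl).1 (hy x rfl).2 using 4 with e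
  simp only [planeSum, hM.planeMap_eq_add_lattice_iff h]
  exact ⟨fun ⟨a, ha⟩ => ⟨a 0, a 1, ha⟩, fun ⟨p, q, hpq⟩ => ⟨![p, q], hpq⟩⟩

theorem encard_preimage (hM : IsHyperbolicUnit M) (hN : Numeration (eigen M) (conjEigen M) r c d D)
    (h : (u, v) ≠ (0, 0)) {z : UnitAddTorus (Fin 2)}
    (hz : ∀ x, proj (planeMap M u v x) = z → Transcendental ℚ (x 0) ∧ Transcendental ℚ (x 1)) :
    {e | e ∈ admissibleSet (eigen M) d ∧ hM.phi u v e = z}.encard =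
      ((assocForm M u v).natAbs : ℕ) := by
  obtain ⟨y, rfl⟩ := proj_surjective z
  have hunique (k : Fin 2 → ℤ) := hM.existsUnique_planeSum_eq hN h (y := y + intVec k)
    fun x hx => hz x (hx.trans (proj_eq_iff.2 ⟨k, rfl⟩))
  set S := {e | e ∈ admissibleSet (eigen M) d ∧ hM.phi u v e = proj y}
  set L := LinearMap.range (latticeMatrix M u v).toLin'
  choose κ hκ using fun e : S => proj_eq_iff.1 e.2.2
  have hbij : Function.Bijective fun e : S => (Submodule.Quotient.mk (κ e) : (Fin 2 → ℤ) ⧸ L) := by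
    constructor
    · intro e e' hee'
      obtain ⟨a, ha⟩ := (Submodule.Quotient.eq L).1 hee'
      refine Subtype.ext ((hunique (κ e')).unique ⟨e.2.1, a, ?_⟩ ⟨e'.2.1, 0, ?_⟩)
      · rw [hκ, ← Matrix.toLin'_apply, ha, add_assoc, ← map_add, add_sub_cancel]
      · rw [hκ, Matrix.mulVec_zero, map_zero, add_zero]
    · intro q
      obtain ⟨k, rfl⟩ := Submodule.Quotient.mk_surjective L q
      obtain ⟨e, ⟨he, a, ha⟩, -⟩ := hunique k
      rw [add_assoc, ← map_add] at ha
      have heS : e ∈ S := ⟨he, proj_eq_iff.2 ⟨_, ha⟩⟩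
      have hκa := intVec_injective (add_left_cancel ((hκ ⟨e, heS⟩).symm.trans ha))
      refine ⟨⟨e, heS⟩, (Submodule.Quotient.eq L).2 ⟨a, ?_⟩⟩
      rw [hκa, add_sub_cancel_left, Matrix.toLin'_apply]
  have hcard : Nat.card ((Fin 2 → ℤ) ⧸ L) = (assocForm M u v).natAbs := by
    rw [natCard_quotient_range_toLin' (hM.det_latticeMatrix_ne_zero h),
      hM.natAbs_det_latticeMatrix]
  have : Finite ((Fin 2 → ℤ) ⧸ L) :=
    Nat.finite_of_card_ne_zero (hcard ▸ Int.natAbs_ne_zero.2 (hM.assocForm_ne_zero h))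
  rw [Set.encard, ENat.card_congr (Equiv.ofBijective _ hbij), ENat.card_eq_coe_natCard, hcard]

theorem phi_surjOn (hM : IsHyperbolicUnit M) (hN : Numeration (eigen M) (conjEigen M) r c d D)
    (h : (u, v) ≠ (0, 0)) : Set.SurjOn (hM.phi u v) (admissibleSet (eigen M) d) Set.univ := by
  set ψ : (ℤ → ℕ) → UnitAddTorus (Fin 2) := fun e => proj (planeSum M u v e)
  set A : Set (ℤ → ℕ) := {e | IsAdmissible d e}
  have hsub : A ⊆ Set.univ.pi fun _ => Set.Iic (d 0) := fun e he n _ => he.le n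
  have hcompact : IsCompact A :=
    (isCompact_univ_pi fun _ => (Set.finite_Iic (d 0)).isCompact).of_isClosed_subset
      (isClosed_setOf_isAdmissible (fun n => continuous_apply n) d) hsub
  have hcont : ContinuousOn ψ A := by
    refine (continuous_proj.comp (planeMap M u v).continuous_of_finiteDimensional).comp_continuousOn
      (continuousOn_pi.2 fun i => ?_)
    fin_cases i
    · exact ((isDominated_futureWeight hM.eigen_pos).continuousOn hM.one_lt_eigen _).mono hsub
    · exact ((isDominated_pastWeight hM.abs_conjEigen).continuousOn hM.one_lt_eigen _).mono hsub
  have hclosed : IsClosed (ψ '' A) := (hcompact.image_of_continuousOn hcont).isClosed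
  have hdense : Dense (ψ '' A) := by
    refine MeasureTheory.Measure.dense_of_ae (μ := MeasureTheory.volume) ?_
    filter_upwards [hM.ae_transcendental h] with z hz
    have hcard : {e | e ∈ admissibleSet (eigen M) d ∧ hM.phi u v e = z}.encard ≠ 0 := by
      rw [hM.encard_preimage hN h hz]
      exact_mod_cast Int.natAbs_ne_zero.2 (hM.assocForm_ne_zero h)
    obtain ⟨e, he, rfl⟩ := Set.encard_ne_zero.1 hcard
    exact ⟨e.1, he, rfl⟩
  intro z _
  obtain ⟨e, he, rfl⟩ : z ∈ ψ '' A :=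
    (hclosed.closure_eq.symm.trans hdense.closure_eq) ▸ Set.mem_univ z
  exact ⟨ofBounded hM.one_lt_eigen e (d 0) he.le, he, rfl⟩

theorem eq_of_phi_eq_of_isFinite (hM : IsHyperbolicUnit M)
    (hN : Numeration (eigen M) (conjEigen M) r c d D) (h : (u, v) ≠ (0, 0)) (n : ℕ)
    {e e' : PrimarySeq (eigen M)} (he : IsAdmissible d e.1) (he' : IsAdmissible d e'.1)
    (hf : IsFinite e) (hf' : IsFinite e') (hzero : ∀ m ≤ -(n : ℤ), e.1 m = 0)
    (hzero' : ∀ m ≤ -(n : ℤ), e'.1 m = 0) (heq : hM.phi u v e = hM.phi u v e') : e = e' := by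
  induction n generalizing e e' with
  | zero =>
    simp only [Nat.cast_zero, neg_zero] at hzero hzero'
    rw [phi_apply, phi_apply, planeSum_eq_of_forall_nonpos hzero,
      planeSum_eq_of_forall_nonpos hzero', ← sub_eq_zero, ← map_sub, ← sub_smul] at heq
    have hfuture := sub_eq_zero.1 (hM.eq_zero_of_proj_smul_homoclinicPoint h heq)
    ext m
    rcases le_or_gt m 0 with hm | hm
    · rw [hzero m hm, hzero' m hm]
    · obtain ⟨j, rfl⟩ : ∃ j : ℕ, m = j + 1 := ⟨(m - 1).toNat, by omega⟩
      exact hN.apply_eq_of_future_eq he he' hf hf' hfuture j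
  | succ n ih =>
    obtain ⟨f, hfa, rfl⟩ := he.exists_shift_eq hM.one_lt_eigen
    obtain ⟨f', hfa', rfl⟩ := he'.exists_shift_eq hM.one_lt_eigen
    have hvanish {g : PrimarySeq (eigen M)} (hg : ∀ m ≤ -((n + 1 : ℕ) : ℤ), (shift g).1 m = 0) :
        ∀ m ≤ -(n : ℤ), g.1 m = 0 := fun m hm => by
      simpa [shift_apply] using hg (m - 1) (by push_cast; omega)
    rw [hM.phi_shift, hM.phi_shift] at heq
    rw [ih hfa hfa' (isFinite_shift.1 hf) (isFinite_shift.1 hf') (hvanish hzero) (hvanish hzero')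
      (toralMap_injective hM.isUnit_det heq)]

theorem injOn_isFinite (hM : IsHyperbolicUnit M) (hN : Numeration (eigen M) (conjEigen M) r c d D)
    (h : (u, v) ≠ (0, 0)) :
    Set.InjOn (hM.phi u v) {e | e ∈ admissibleSet (eigen M) d ∧ IsFinite e} := by
  rintro e ⟨he, hf⟩ e' ⟨he', hf'⟩ heq
  obtain ⟨n, hn⟩ := hf.exists_bounds
  obtain ⟨n', hn'⟩ := hf'.exists_bounds
  refine hM.eq_of_phi_eq_of_isFinite hN h (max n n') he he' hf hf' (fun m hm => ?_)
    (fun m hm => ?_) heq <;> by_contra hne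
  · have := (hn m hne).1
    omega
  · have := (hn' m hne).1
    omega

theorem isArithmeticCoding_phi (hM : IsHyperbolicUnit M)
    (hN : Numeration (eigen M) (conjEigen M) r c d D) (h : (u, v) ≠ (0, 0)) :
    IsArithmeticCoding M (hM.phi u v) (admissibleSet (eigen M) d) where
  continuous := hM.continuous_phi u v
  equivariant := hM.phi_shift u v
  closed := @isClosed_setOf_isAdmissible _ (seqTopology (eigen M)) _
    (fun n => continuous_coord hM.one_lt_eigen n) d
  shift_invariant _ := isAdmissible_shift
  total := fun _ he _ ⟨N, hlt⟩ k hk => he N (hk.trans (hlt k))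
  surjective x := hM.phi_surjOn hN h (Set.mem_univ x)
  injective_finite := hM.injOn_isFinite hN h

end IsHyperbolicUnit

/-! ### The structure of an arbitrary coding -/

/-- `x` is lexicographically less than `y`, and their first difference is at an index less than
`i`. -/
def LexLessBefore (i : ℕ) (x y : ℕ → ℕ) : Prop := ∃ k < i, (∀ l < k, x l = y l) ∧ x k < y k

namespace LexLessBefore

variable {i : ℕ} {x y z : ℕ → ℕ}

theorem lexLess (h : LexLessBefore i x y) : LexLess x y :=
  let ⟨k, _, hk⟩ := h
  ⟨k, hk⟩

theorem trans_lexLess (h : LexLessBefore i y z) (h' : LexLess x y) : LexLessBefore i x z := by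
  obtain ⟨k, hki, hagree, hlt⟩ := h
  obtain ⟨l, hagree', hlt'⟩ := h'
  refine ⟨min l k, (min_le_right _ _).trans_lt hki, fun m hm => ?_, ?_⟩
  · rw [hagree' m (lt_min_iff.1 hm).1, hagree m (lt_min_iff.1 hm).2]
  · rcases lt_trichotomy l k with hlk | rfl | hkl
    · rwa [min_eq_left hlk.le, ← hagree l hlk]
    · rw [min_self]
      exact hlt'.trans hlt
    · rwa [min_eq_right hkl.le, hagree' k hkl]

theorem lexLess_of_not (h : LexLessBefore i x z) (h' : ¬ LexLessBefore i y z) : LexLess x y := by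
  rw [lexLess_iff_toLex_lt]
  refine (lt_trichotomy (toLex x) (toLex y)).resolve_right ?_
  rintro (heq | hlt)
  · exact h' (toLex.injective heq ▸ h)
  · exact h' (h.trans_lexLess hlt)

end LexLessBefore

theorem volume_eq_zero_of_subset_affine {ι : Type*} {s : Finset ι} {a b : ι → ℝ} {F : Set ℝ}
    (ha : ∀ j ∈ s, 0 ≤ a j) (hsum : ∑ j ∈ s, a j < 1) (hF : MeasureTheory.volume F ≠ ⊤)
    (hcover : F ⊆ ⋃ j ∈ s, (fun x => b j + a j * x) '' F) : MeasureTheory.volume F = 0 := by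
  have hvolume (j : ι) (hj : j ∈ s) : MeasureTheory.volume ((fun x => b j + a j * x) '' F) =
      ENNReal.ofReal (a j) * MeasureTheory.volume F := by
    rw [← Set.image_image (b j + ·) (a j * ·), Set.image_add_left,
      MeasureTheory.measure_preimage_add]
    exact (MeasureTheory.Measure.addHaar_smul MeasureTheory.volume (a j) F).trans
      (by simp [abs_of_nonneg (ha j hj)])
  have hle : MeasureTheory.volume F ≤
      ENNReal.ofReal (∑ j ∈ s, a j) * MeasureTheory.volume F := by
    rw [ENNReal.ofReal_sum_of_nonneg ha, Finset.sum_mul, ← Finset.sum_congr rfl hvolume]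
    exact (MeasureTheory.measure_mono hcover).trans (MeasureTheory.measure_biUnion_finset_le _ _)
  by_contra hne
  refine hle.not_gt ?_
  simpa using ENNReal.mul_lt_mul_left hne hF (ENNReal.ofReal_lt_one.2 hsum)

namespace Numeration

variable {lam mu : ℝ} {r c : ℕ} {d : ℕ → ℕ} {D : ℕ → ℝ}

theorem digit_zero_pos (hN : Numeration lam mu r c d D) : 0 < d 0 := by
  rw [hN.digit_zero]
  have : (0 : ℝ) < c := by linarith [hN.one_lt, hN.lt_digit]
  exact_mod_cast this

theorem frequently_digit_ne_zero (hN : Numeration lam mu r c d D) :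
    ∃ᶠ n in Filter.atTop, d n ≠ 0 := by
  rw [Filter.frequently_atTop]
  intro m
  by_contra! hzero
  have hgrowth (l : ℕ) : D (m + l) = lam ^ l * D m := by
    induction l with
    | zero => simp
    | succ l ih =>
      rw [← add_assoc, hN.value_succ, hzero _ (by omega), ih, Nat.cast_zero, sub_zero, pow_succ',
        mul_assoc]
  obtain ⟨l, hl⟩ := pow_unbounded_of_one_lt (1 / D m) hN.one_lt
  exact (hN.value_le (m + l)).not_gt (hgrowth l ▸ (div_lt_iff₀ (hN.value_pos m)).1 hl)

theorem exists_forall_lexLessBefore (hN : Numeration lam mu r c d D) {f : PrimarySeq lam}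
    (hf : IsAdmissible d f.1) (hfin : IsFinite f) : ∃ i, ∀ k, LexLessBefore i (tail f k) d := by
  have hlt (k : ℤ) : ∃ j, (∀ l < j, tail f k l = d l) ∧ tail f k j < d j :=
    lexLess_iff_toLex_lt.2 ((not_lt.1 fun h => hf k (lexLess_iff_toLex_lt.2 h)).lt_of_ne
      fun h => hfin.tail_ne hN.frequently_digit_ne_zero k (toLex.injective h))
  choose j hj using hlt
  refine ⟨hfin.toFinset.sup j + 1, fun k => ?_⟩
  by_cases hk : f.1 k = 0
  · exact ⟨0, Nat.succ_pos _, by simp, by simpa [tail, hk] using hN.digit_zero_pos⟩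
  · exact ⟨j k, Nat.lt_succ_of_le (Finset.le_sup (f := j) (hfin.mem_toFinset.2 hk)), hj k⟩

theorem sum_digits (hN : Numeration lam mu r c d D) (i : ℕ) :
    ∑ k ∈ Finset.range i, (d k : ℝ) / lam ^ (k + 1) = 1 - D i / lam ^ i := by
  have hlam := hN.lam_pos.ne'
  induction i with
  | zero => simp [hN.value_zero]
  | succ i ih =>
    rw [Finset.sum_range_succ, ih, hN.value_succ]
    field_simp
    ring

theorem future_eq_add_mul (hN : Numeration lam mu r c d D) {e : PrimarySeq lam} {k : ℕ}
    (h : ∀ l < k, e.1 (l + 1) = d l) :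
    future lam e.1 = 1 - D k / lam ^ k + e.1 (k + 1) / lam ^ (k + 1) +
      1 / lam ^ (k + 1) * future lam (shift^[k + 1] e).1 := by
  have hlam := hN.lam_pos.ne'
  rw [future_shift_iterate_succ hN.one_lt, eq_add_of_sub_eq (hN.future_sub_value e h)]
  field_simp
  ring

/-- The set of the values is covered by the contracted copies of itself, one for every digit block
dropping below `d` before the index `i`, and the contraction ratios add up to less than `1`. -/
theorem volume_future_eq_zero (hN : Numeration lam mu r c d D) {X : Set (PrimarySeq lam)}
    (hX : Set.MapsTo shift X X) {i : ℕ} (h : ∀ e ∈ X, ∀ k, LexLessBefore i (tail e k) d) :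
    MeasureTheory.volume ((fun e : PrimarySeq lam => future lam e.1) '' X) = 0 := by
  have hlam := hN.lam_pos
  set F := (fun e : PrimarySeq lam => future lam e.1) '' X
  have hbounded : F ⊆ Set.Icc 0 1 := by
    rintro _ ⟨e, he, rfl⟩
    exact ⟨future_nonneg hlam _,
      hN.future_le_one fun k hk => lt_asymm (lexLess_iff_toLex_lt.1 hk) (h e he k).lexLess⟩
  refine volume_eq_zero_of_subset_affine
    (s := (Finset.range i).sigma fun k => Finset.range (d k))
    (a := fun j => 1 / lam ^ (j.1 + 1))
    (b := fun j => 1 - D j.1 / lam ^ j.1 + j.2 / lam ^ (j.1 + 1))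
    (fun _ _ => by positivity) ?_ ((MeasureTheory.measure_mono hbounded).trans_lt (by simp)).ne ?_
  · have hratio : 0 < D i / lam ^ i := div_pos (hN.value_pos i) (pow_pos hlam i)
    simp only [Finset.sum_sigma, Finset.sum_const, Finset.card_range, nsmul_eq_mul, mul_one_div]
    rw [hN.sum_digits]
    linarith
  · rintro _ ⟨e, he, rfl⟩
    obtain ⟨k, hk, hagree, hlt⟩ := h e he 1
    simp only [tail, add_comm (1 : ℤ)] at hagree hlt
    refine Set.mem_iUnion₂.2 ⟨⟨k, e.1 (k + 1)⟩, by simp [hk, hlt], _,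
      ⟨_, hX.iterate (k + 1) he, rfl⟩, (hN.future_eq_add_mul hagree).symm⟩

end Numeration

namespace IsHyperbolicUnit

variable {M : Matrix (Fin 2) (Fin 2) ℤ} {u v : ℤ} {r c : ℕ} {d : ℕ → ℕ} {D : ℕ → ℝ}
  {X : Set (PrimarySeq (eigen M))}

theorem isAdmissible_or_eventually_zero (hM : IsHyperbolicUnit M)
    (hN : Numeration (eigen M) (conjEigen M) r c d D) (hX : IsArithmeticCoding M (hM.phi u v) X)
    {e : PrimarySeq (eigen M)} (he : e ∈ X) :
    IsAdmissible d e.1 ∨ ∃ N, ∀ᶠ n in Filter.atTop, tail e N n = 0 := by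
  by_contra! hcon
  obtain ⟨hadm, hne⟩ := hcon
  obtain ⟨N, hlex⟩ : ∃ N, LexLess d (tail e N) := by
    by_contra! hnot
    exact hadm hnot
  obtain ⟨m, g, h, hg, hh, hgh, hg_lt, hh_lt, hfuture, hpast⟩ :=
    hN.collision _ hlex (hne N)
  have htail : (fun n => tail e N (n + m)) = tail e (N + m) := by
    ext n
    rw [tail, tail, Nat.cast_add, add_right_comm, add_assoc]
  rw [htail] at hg_lt hh_lt
  refine hgh (hX.injective_finite ⟨hX.total e he g ⟨_, hg_lt⟩, hg⟩
    ⟨hX.total e he h ⟨_, hh_lt⟩, hh⟩ ?_)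
  rw [phi_apply, phi_apply, planeSum, planeSum, hfuture, hpast]

theorem exists_not_lexLessBefore (hM : IsHyperbolicUnit M)
    (hN : Numeration (eigen M) (conjEigen M) r c d D) (h : (u, v) ≠ (0, 0))
    (hX : IsArithmeticCoding M (hM.phi u v) X) (i : ℕ) :
    ∃ e ∈ X, ∃ N, ¬ LexLessBefore i (tail e N) d := by
  by_contra! hbefore
  have hnull := hN.volume_future_eq_zero (fun e he => (hX.shift_invariant e).2 he) hbefore
  obtain ⟨z, hz⟩ := (hM.ae_planeMap_coord_notMem h 0 hnull).exists
  obtain ⟨e, he, rfl⟩ := hX.surjective z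
  exact hz _ rfl ⟨e, he, rfl⟩

theorem admissibleSet_subset (hM : IsHyperbolicUnit M)
    (hN : Numeration (eigen M) (conjEigen M) r c d D) (h : (u, v) ≠ (0, 0))
    (hX : IsArithmeticCoding M (hM.phi u v) X) : admissibleSet (eigen M) d ⊆ X := by
  have hfinite (f : PrimarySeq (eigen M)) (hf : IsAdmissible d f.1) (hfin : IsFinite f) :
      f ∈ X := by
    obtain ⟨i, hi⟩ := hN.exists_forall_lexLessBefore hf hfin
    obtain ⟨e, he, N, heN⟩ := hM.exists_not_lexLessBefore hN h hX i
    exact hX.total e he f ⟨N, fun k => (hi k).lexLess_of_not heN⟩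
  intro e he
  refine @IsClosed.mem_of_tendsto _ (seqTopology (eigen M)) _ _ _ _ _ _ hX.closed
    (tendsto_restrict e) (Filter.Eventually.of_forall fun s => hfinite _ ?_ (isFinite_restrict e s))
  refine IsAdmissible.mono he fun n => ?_
  rw [restrict_apply]
  split_ifs
  exacts [le_rfl, Nat.zero_le _]

theorem isKToOne (hM : IsHyperbolicUnit M) (h : (u, v) ≠ (0, 0))
    (hX : IsArithmeticCoding M (hM.phi u v) X) :
    IsKToOne (hM.phi u v) X (assocForm M u v).natAbs := by
  obtain ⟨r, c, d, D, hN⟩ := hM.exists_numeration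
  filter_upwards [hM.ae_transcendental h] with z hz
  rw [← hM.encard_preimage hN h hz]
  congr 1
  ext e
  refine ⟨fun ⟨he, hez⟩ => ⟨?_, hez⟩, fun ⟨he, hez⟩ => ⟨hM.admissibleSet_subset hN h hX he, hez⟩⟩
  refine (hM.isAdmissible_or_eventually_zero hN hX he).resolve_right fun ⟨N, hN0⟩ => ?_
  have htranscendental (k : ℕ) : Transcendental ℚ (future (eigen M) (shift^[k] e).1) := by
    induction k with
    | zero => exact (hz _ hez).1
    | succ k ih => rwa [Function.iterate_succ_apply', hN.transcendental_future_shift]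
  obtain ⟨m, hm⟩ := Filter.eventually_atTop.1 hN0
  refine htranscendental (N + m).toNat ?_
  rw [future_eq_zero]
  · exact isAlgebraic_zero
  · intro n hn
    rw [shift_iterate_apply]
    have := hm (n + (N + m).toNat - N).toNat (by omega)
    rwa [tail, Int.toNat_of_nonneg (by omega), add_sub_cancel] at this

end IsHyperbolicUnit

/-! ### Homoclinic points -/

section Lifts

variable {M : Matrix (Fin 2) (Fin 2) ℤ}

theorem exists_proj_eq_norm_eq (z : UnitAddTorus (Fin 2)) : ∃ y, proj y = z ∧ ‖y‖ = ‖z‖ := by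
  obtain ⟨y, rfl⟩ := proj_surjective z
  refine ⟨y - intVec (round ∘ y), ?_, ?_⟩
  · rw [map_sub, sub_eq_self, proj_eq_zero_iff]
    exact ⟨_, rfl⟩
  · rw [Pi.norm_def, Pi.norm_def]
    exact congrArg _ (congrArg _ (funext fun i => NNReal.coe_injective
      (UnitAddCircle.norm_eq (x := y i)).symm))

theorem eq_of_proj_eq_of_norm_sub_lt_one {y y' : Fin 2 → ℝ} (h : proj y = proj y')
    (hlt : ‖y - y'‖ < 1) : y = y' := by
  obtain ⟨k, rfl⟩ := proj_eq_iff.1 h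
  rw [add_sub_cancel_left] at hlt
  have hzero : k = 0 := funext fun i => Int.abs_lt_one_iff.1 (by
    have hi := (norm_le_pi_norm (intVec k) i).trans_lt hlt
    rw [intVec_apply, Real.norm_eq_abs] at hi
    exact_mod_cast hi)
  rw [hzero, map_zero, add_zero]

theorem exists_lift_orbit {a : ℤ → UnitAddTorus (Fin 2)} (ha : ∀ n, a (n + 1) = toralMap M (a n))
    (hlim : Filter.Tendsto a Filter.cofinite (𝓝 0)) :
    ∃ s : ℤ → Fin 2 → ℝ, (∀ n, proj (s n) = a n) ∧ (∀ n, ‖s n‖ ≤ 1) ∧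
      ∀ᶠ n in Filter.cofinite, s (n + 1) = realMap M (s n) := by
  choose s hproj hnorm using fun n => exists_proj_eq_norm_eq (a n)
  have hs : Filter.Tendsto s Filter.cofinite (𝓝 0) := by
    rw [tendsto_zero_iff_norm_tendsto_zero] at hlim ⊢
    simpa only [hnorm] using hlim
  have hdiff : Filter.Tendsto (fun n => s (n + 1) - realMap M (s n)) Filter.cofinite (𝓝 0) := by
    have hmap := ((realMap M).continuous_of_finiteDimensional.tendsto 0).comp hs
    simpa only [map_zero, sub_zero, Function.comp_apply] using
      (hs.comp (add_left_injective 1).tendsto_cofinite).sub hmap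
  refine ⟨s, hproj, fun n => ?_, ?_⟩
  · rw [hnorm, pi_norm_le_iff_of_nonneg zero_le_one]
    exact fun i => (AddCircle.norm_le_half_period (1 : ℝ) one_ne_zero).trans (by norm_num)
  · filter_upwards [(tendsto_zero_iff_norm_tendsto_zero.1 hdiff).eventually_lt_const one_pos]
      with n hn
    exact eq_of_proj_eq_of_norm_sub_lt_one
      (by rw [hproj, ha, ← hproj n, toralMap_proj]) hn

theorem exists_norm_realMap_sub_smul_le (M : Matrix (Fin 2) (Fin 2) ℤ) (b : ℝ) :
    ∃ C, ∀ x, ‖x‖ ≤ 1 → ‖realMap M x - b • x‖ ≤ C :=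
  ⟨_, fun x hx => (realMap M - b • LinearMap.id).toContinuousLinearMap.unit_le_opNorm x hx⟩

theorem realMap_realMap_sub_smul {a b : ℝ} (hadd : a + b = M.trace) (hmul : a * b = M.det)
    (x : Fin 2 → ℝ) : realMap M (realMap M x - b • x) = a • (realMap M x - b • x) := by
  rw [map_sub, map_smul, realMap_realMap, ← hadd, ← hmul]
  module

theorem exists_proj_eq_of_eigenvector (hdet : IsUnit M.det) {b : ℝ} (hb : b ≠ 0)
    {a : ℤ → UnitAddTorus (Fin 2)} (ha : ∀ n, a (n + 1) = toralMap M (a n)) {n : ℤ}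
    (h : ∃ x, realMap M x = b • x ∧ proj x = a n) (m : ℤ) :
    ∃ x, realMap M x = b • x ∧ proj x = a m := by
  induction m using Int.inductionOn' (b := n) with
  | zero => exact h
  | succ m _ ih =>
    obtain ⟨x, hx, hproj⟩ := ih
    exact ⟨b • x, by rw [map_smul, hx], by rw [← hx, ← toralMap_proj, hproj, ha]⟩
  | pred m _ ih =>
    obtain ⟨x, hx, hproj⟩ := ih
    have hmap : realMap M (b⁻¹ • x) = x := by rw [map_smul, hx, inv_smul_smul₀ hb]
    refine ⟨b⁻¹ • x, by rw [hmap, smul_inv_smul₀ hb], toralMap_injective hdet ?_⟩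
    rw [toralMap_proj, hmap, hproj, ← ha, sub_add_cancel]

end Lifts

theorem tendsto_apply_single {lam : ℝ} (hlam : 1 < lam)
    {φ : PrimarySeq lam →+ UnitAddTorus (Fin 2)}
    (hφ : Continuous[seqTopology lam, inferInstance] φ) :
    Filter.Tendsto (fun n => φ (single lam n)) Filter.cofinite (𝓝 0) := by
  have hsum := hasSum_of_continuous hφ (ofBounded hlam (fun _ => 1) 1 fun _ => le_rfl)
  simpa only [ofBounded, one_smul] using hsum.summable.tendsto_cofinite_zero

theorem apply_single_eq_of_equivariant {M : Matrix (Fin 2) (Fin 2) ℤ} (hdet : IsUnit M.det)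
    {lam : ℝ} {φ ψ : PrimarySeq lam →+ UnitAddTorus (Fin 2)}
    (hφ : ∀ e, φ (shift e) = toralMap M (φ e)) (hψ : ∀ e, ψ (shift e) = toralMap M (ψ e))
    (h : φ (single lam 0) = ψ (single lam 0)) (n : ℤ) :
    φ (single lam n) = ψ (single lam n) := by
  induction n with
  | zero => exact h
  | succ n ih =>
    apply toralMap_injective hdet
    rwa [← hφ, ← hψ, shift_single, add_sub_cancel_right]
  | pred n ih => rw [← shift_single, hφ, hψ, ih]

namespace IsHyperbolicUnit

variable {M : Matrix (Fin 2) (Fin 2) ℤ}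

theorem phi_single (hM : IsHyperbolicUnit M) (u v n : ℤ) :
    hM.phi u v (single (eigen M) n) = proj (eigen M ^ (-n) • homoclinicPoint M u v) := by
  have hpos (n : ℤ) (hn : 1 ≤ n) :
      hM.phi u v (single (eigen M) n) = proj (eigen M ^ (-n) • homoclinicPoint M u v) := by
    rw [phi_apply, planeSum_eq_of_forall_nonpos, future, weightedSum_single, futureWeight,
      if_pos (by omega)]
    exact fun m hm => by rw [single_apply, if_neg (by omega)]
  rcases le_total 1 n with hn | hn
  · exact hpos n hn
  · induction n, hn using Int.leInductionDown with
    | base => exact hpos 1 le_rfl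
    | pred n _ ih =>
      rw [← shift_single, phi_shift, ih, toralMap_proj, map_smul, hM.realMap_homoclinicPoint,
        smul_smul, ← zpow_add_one₀ hM.eigen_pos.ne', neg_sub', sub_neg_eq_add]

theorem isGivenBySeries_phi (hM : IsHyperbolicUnit M) (u v : ℤ) :
    IsGivenBySeries (hM.phi u v) (homoclinicPoint M u v) := by
  intro e
  have hIcc : Filter.Tendsto (fun N : ℕ => Finset.Icc (-(N : ℤ)) N) Filter.atTop Filter.atTop := by
    refine Filter.tendsto_atTop_finset_of_monotone
      (fun a b hab => Finset.Icc_subset_Icc (by omega) (by omega)) fun x => ⟨x.natAbs, ?_⟩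
    rw [Finset.mem_Icc]
    omega
  have hpartial (N : ℕ) : ∑ n ∈ Finset.Icc (-(N : ℤ)) N, e.1 n • hM.phi u v (single (eigen M) n) =
      proj ((∑ n ∈ Finset.Icc (-(N : ℤ)) N, (e.1 n : ℝ) * eigen M ^ (-n)) •
        homoclinicPoint M u v) := by
    simp only [Finset.sum_smul, map_sum, hM.phi_single, ← map_nsmul, mul_smul,
      Nat.cast_smul_eq_nsmul]
  exact ((hasSum_of_continuous (hM.continuous_phi u v) e).comp hIcc).congr hpartial

theorem exists_eq_homoclinicPoint (hM : IsHyperbolicUnit M) {x x' : Fin 2 → ℝ}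
    (hx : realMap M x = eigen M • x) (hx' : realMap M x' = conjEigen M • x')
    (h : proj x = proj x') : ∃ u v, x = homoclinicPoint M u v := by
  obtain ⟨k, hk⟩ := proj_eq_iff.1 h
  obtain ⟨u, v, huv⟩ := hM.exists_latticeVec_eq k
  refine ⟨u, v, smul_right_injective _ hM.eigen_sub_conjEigen_ne_zero ?_⟩
  beta_reduce
  rw [hM.sub_smul_homoclinicPoint, huv, ← sub_eq_iff_eq_add'.2 hk, map_sub, hx, hx']
  module

theorem realMap_eq_conjEigen_smul (hM : IsHyperbolicUnit M) {s : ℕ → Fin 2 → ℝ}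
    (hs : ∀ n, ‖s n‖ ≤ 1) (hstep : ∀ n, s (n + 1) = realMap M (s n)) :
    realMap M (s 0) = conjEigen M • s 0 := by
  obtain ⟨C, hC⟩ := exists_norm_realMap_sub_smul_le M (conjEigen M)
  refine sub_eq_zero.1 (eq_zero_of_bounded_of_expanding hM.one_lt_eigen
    (f := fun n => realMap M (s n) - conjEigen M • s n) (fun n => ?_) fun n => hC _ (hs n))
  rw [hstep, ← map_smul, ← map_sub,
    realMap_realMap_sub_smul (eigen_add_conjEigen M) hM.eigen_mul_conjEigen, norm_smul,
    Real.norm_of_nonneg hM.eigen_pos.le]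

theorem realMap_eq_eigen_smul (hM : IsHyperbolicUnit M) {s : ℕ → Fin 2 → ℝ}
    (hs : ∀ n, ‖s n‖ ≤ 1) (hstep : ∀ n, s n = realMap M (s (n + 1))) :
    realMap M (s 0) = eigen M • s 0 := by
  obtain ⟨C, hC⟩ := exists_norm_realMap_sub_smul_le M (eigen M)
  refine sub_eq_zero.1 (eq_zero_of_bounded_of_expanding hM.one_lt_eigen
    (f := fun n => realMap M (s n) - eigen M • s n) (fun n => ?_) fun n => hC _ (hs n))
  rw [hstep n, ← map_smul, ← map_sub, realMap_realMap_sub_smul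
    ((add_comm _ _).trans (eigen_add_conjEigen M))
    ((mul_comm _ _).trans hM.eigen_mul_conjEigen), norm_smul, Real.norm_eq_abs (conjEigen M),
    hM.abs_conjEigen, mul_inv_cancel_left₀ hM.eigen_pos.ne']

theorem exists_eq_proj_homoclinicPoint (hM : IsHyperbolicUnit M) {a : ℤ → UnitAddTorus (Fin 2)}
    (ha : ∀ n, a (n + 1) = toralMap M (a n)) (hlim : Filter.Tendsto a Filter.cofinite (𝓝 0)) :
    ∃ u v, a 0 = proj (homoclinicPoint M u v) := by
  obtain ⟨s, hproj, hs, hstep⟩ := exists_lift_orbit ha hlim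
  rw [Int.cofinite_eq, Filter.eventually_sup, Filter.eventually_atBot,
    Filter.eventually_atTop] at hstep
  obtain ⟨⟨m, hm⟩, ⟨n, hn⟩⟩ := hstep
  have hpast : realMap M (s m) = eigen M • s m := by
    simpa using hM.realMap_eq_eigen_smul (s := fun k : ℕ => s (m - k)) (fun _ => hs _) fun k => by
      rw [← hm _ (by omega)]
      congr 1
      push_cast
      ring
  have hfuture : realMap M (s n) = conjEigen M • s n := by
    simpa using hM.realMap_eq_conjEigen_smul (s := fun k : ℕ => s (n + k)) (fun _ => hs _)
      fun k => by rw [← hn _ (by omega), Nat.cast_succ, add_assoc]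
  obtain ⟨x, hx, hxa⟩ := exists_proj_eq_of_eigenvector hM.isUnit_det hM.eigen_pos.ne' ha
    ⟨s m, hpast, hproj m⟩ 0
  obtain ⟨x', hx', hxa'⟩ := exists_proj_eq_of_eigenvector hM.isUnit_det hM.conjEigen_ne_zero ha
    ⟨s n, hfuture, hproj n⟩ 0
  obtain ⟨u, v, rfl⟩ := hM.exists_eq_homoclinicPoint hx hx' (hxa.trans hxa'.symm)
  exact ⟨u, v, hxa.symm⟩

theorem exists_eq_phi (hM : IsHyperbolicUnit M)
    {φ : PrimarySeq (eigen M) →+ UnitAddTorus (Fin 2)}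
    (hφ : Continuous[seqTopology (eigen M), inferInstance] φ)
    (hequiv : ∀ e, φ (shift e) = toralMap M (φ e)) : ∃ u v, φ = hM.phi u v := by
  have horbit (n : ℤ) : φ (single _ (-(n + 1))) = toralMap M (φ (single _ (-n))) := by
    rw [← hequiv, shift_single, neg_add']
  obtain ⟨u, v, huv⟩ := hM.exists_eq_proj_homoclinicPoint (a := fun n => φ (single _ (-n))) horbit
    ((tendsto_apply_single hM.one_lt_eigen hφ).comp neg_injective.tendsto_cofinite)
  refine ⟨u, v, AddMonoidHom.ext fun e => (hasSum_of_continuous hφ e).unique ?_⟩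
  have hsingle := apply_single_eq_of_equivariant hM.isUnit_det hequiv (hM.phi_shift u v)
    (by simpa [hM.phi_single] using huv)
  simpa only [hsingle] using hasSum_of_continuous (hM.continuous_phi u v) e

theorem phi_zero (hM : IsHyperbolicUnit M) : hM.phi 0 0 = 0 := by
  have hpoint : homoclinicPoint M 0 0 = 0 := by
    simpa using homoclinicPoint_sub (M := M) (u := 0) (v := 0) 0 0
  ext1 e
  refine (hasSum_of_continuous (hM.continuous_phi 0 0) e).unique ?_
  simp only [hM.phi_single, hpoint, smul_zero, map_zero]
  exact hasSum_zero

theorem exists_eq_phi_of_coding (hM : IsHyperbolicUnit M)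
    {φ : PrimarySeq (eigen M) →+ UnitAddTorus (Fin 2)} {X : Set (PrimarySeq (eigen M))}
    (hX : IsArithmeticCoding M φ X) : ∃ u v, (u, v) ≠ (0, 0) ∧ φ = hM.phi u v := by
  obtain ⟨u, v, rfl⟩ := hM.exists_eq_phi hX.continuous hX.equivariant
  refine ⟨u, v, fun h => ?_, rfl⟩
  obtain ⟨rfl, rfl⟩ := Prod.mk_inj.1 h
  obtain ⟨e, -, he⟩ := hX.surjective (proj fun _ => 2⁻¹)
  rw [hM.phi_zero] at he
  obtain ⟨k, hk⟩ := proj_eq_zero_iff.1 he.symm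
  have hhalf : (2⁻¹ : ℝ) = k 0 := congr_fun hk 0
  have hone : (1 : ℤ) = 2 * k 0 := by
    have : (1 : ℝ) = 2 * k 0 := by rw [← hhalf]; norm_num
    exact_mod_cast this
  omega

theorem phi_injective (hM : IsHyperbolicUnit M) :
    Function.Injective fun p : ℤ × ℤ => hM.phi p.1 p.2 := by
  rintro ⟨u, v⟩ ⟨u', v'⟩ h
  have hzero : proj ((eigen M)⁻¹ • homoclinicPoint M (u - u') (v - v')) = 0 := by
    rw [homoclinicPoint_sub, smul_sub, map_sub, sub_eq_zero, ← zpow_neg_one, ← hM.phi_single,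
      ← hM.phi_single]
    exact DFunLike.congr_fun h _
  by_contra hne
  refine inv_ne_zero hM.eigen_pos.ne' (hM.eq_zero_of_proj_smul_homoclinicPoint (fun h => hne ?_)
    hzero)
  simpa [sub_eq_zero] using h

theorem isKToOne_unique {lam : ℝ} {φ : PrimarySeq lam →+ UnitAddTorus (Fin 2)}
    {X : Set (PrimarySeq lam)} {K K' : ℕ} (h : IsKToOne φ X K) (h' : IsKToOne φ X K') :
    K = K' := by
  obtain ⟨z, hz, hz'⟩ := (h.and h').exists
  exact_mod_cast hz.symm.trans hz'

theorem preimageNumbers_eq (hM : IsHyperbolicUnit M) : preimageNumbers M =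
    {k : ℕ | ∃ u v : ℤ, (u, v) ≠ (0, 0) ∧ k = (assocForm M u v).natAbs} := by
  ext k
  constructor
  · rintro ⟨φ, X, hX, hk⟩
    obtain ⟨u, v, h, rfl⟩ := hM.exists_eq_phi_of_coding hX
    exact ⟨u, v, h, isKToOne_unique hk (hM.isKToOne h hX)⟩
  · rintro ⟨u, v, h, rfl⟩
    obtain ⟨r, c, d, D, hN⟩ := hM.exists_numeration
    exact ⟨_, _, hM.isArithmeticCoding_phi hN h, hM.isKToOne h (hM.isArithmeticCoding_phi hN h)⟩

theorem isLeast_minPreimages (hM : IsHyperbolicUnit M) :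
    IsLeast (preimageNumbers M) (minPreimages M) := by
  refine ⟨Nat.sInf_mem ?_, fun k hk => Nat.sInf_le hk⟩
  rw [hM.preimageNumbers_eq]
  exact ⟨_, 1, 0, by simp, rfl⟩

theorem minPreimages_ne_zero (hM : IsHyperbolicUnit M) : minPreimages M ≠ 0 := by
  obtain ⟨u, v, h, hmin⟩ := hM.preimageNumbers_eq ▸ hM.isLeast_minPreimages.1
  exact hmin ▸ Int.natAbs_ne_zero.2 (hM.assocForm_ne_zero h)

theorem exists_isMinimalCoding_phi_iff (hM : IsHyperbolicUnit M) {u v : ℤ} (h : (u, v) ≠ (0, 0)) :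
    (∃ X, IsMinimalCoding M (hM.phi u v) X) ↔ (assocForm M u v).natAbs = minPreimages M := by
  obtain ⟨r, c, d, D, hN⟩ := hM.exists_numeration
  have hcoding := hM.isArithmeticCoding_phi hN h
  exact ⟨fun ⟨X, hX, hk⟩ => isKToOne_unique (hM.isKToOne h hX) hk,
    fun hk => ⟨_, hcoding, hk ▸ hM.isKToOne h hcoding⟩⟩

theorem bijOn_phi (hM : IsHyperbolicUnit M) :
    Set.BijOn (fun p : ℤ × ℤ => hM.phi p.1 p.2)
      {p | assocForm M p.1 p.2 = (minPreimages M : ℤ) ∨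
        assocForm M p.1 p.2 = -(minPreimages M : ℤ)} {φ | ∃ X, IsMinimalCoding M φ X} := by
  simp only [← Int.natAbs_eq_iff]
  refine ⟨?_, hM.phi_injective.injOn, ?_⟩
  · rintro ⟨u, v⟩ hk
    refine (hM.exists_isMinimalCoding_phi_iff fun h => hM.minPreimages_ne_zero ?_).2 hk
    obtain ⟨rfl, rfl⟩ := Prod.mk_inj.1 h
    simpa [assocForm] using hk.symm
  · rintro φ ⟨X, hX⟩
    obtain ⟨u, v, h, rfl⟩ := hM.exists_eq_phi_of_coding hX.1
    exact ⟨(u, v), (hM.exists_isMinimalCoding_phi_iff h).1 ⟨X, hX⟩, rfl⟩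

end IsHyperbolicUnit

end ArithCoding

end

theorem corollary3p2 (M : Matrix (Fin 2) (Fin 2) ℤ) (hdet : IsUnit M.det)
    (hhyp : ArithCoding.IsHyperbolic M) (htr : 0 < M.trace) :
    -- the number of preimages of an arithmetic coding is well defined and depends on `φ` only
    (∀ φ, ∃ K : ℕ, ∀ X, ArithCoding.IsArithmeticCoding M φ X → ArithCoding.IsKToOne φ X K) ∧
    -- `m(T)` is attained and equals the integral minimum of the associated form
    IsLeast (ArithCoding.preimageNumbers M) (ArithCoding.minPreimages M) ∧
    IsLeast {k : ℕ | ∃ u v : ℤ, (u, v) ≠ (0, 0) ∧ k = (ArithCoding.assocForm M u v).natAbs}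
      (ArithCoding.minPreimages M) ∧
    -- the minimal codings are in bijection with the solutions of `f(u, v) = ± m(T)`
    ∃ Φ : ℤ × ℤ → (ArithCoding.PrimarySeq (ArithCoding.eigen M) →+ UnitAddTorus (Fin 2)),
      (∀ u v : ℤ, ArithCoding.IsGivenBySeries (Φ (u, v)) (ArithCoding.homoclinicPoint M u v)) ∧
      Set.BijOn Φ
        {p | ArithCoding.assocForm M p.1 p.2 = (ArithCoding.minPreimages M : ℤ) ∨
          ArithCoding.assocForm M p.1 p.2 = -(ArithCoding.minPreimages M : ℤ)}
        {φ | ∃ X, ArithCoding.IsMinimalCoding M φ X} := by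
  have hM : ArithCoding.IsHyperbolicUnit M := ⟨hdet, hhyp, htr⟩
  refine ⟨fun φ => ?_, hM.isLeast_minPreimages, hM.preimageNumbers_eq ▸ hM.isLeast_minPreimages,
    fun p => hM.phi p.1 p.2, hM.isGivenBySeries_phi, hM.bijOn_phi⟩
  by_cases hX : ∃ X, ArithCoding.IsArithmeticCoding M φ X
  · obtain ⟨X, hX⟩ := hX
    obtain ⟨u, v, h, rfl⟩ := hM.exists_eq_phi_of_coding hX
    exact ⟨_, fun X hX => hM.isKToOne h hX⟩
  · exact ⟨0, fun X h => absurd ⟨X, h⟩ hX⟩
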